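/- By a tiling we mean an edge-to-edge tiling of the sphere by finitely many pentagons (a finite cell decomposition of the sphere in which the boundary of every tile is a simple closed path of five edges and every vertex has degree at least $3$), in which every corner of every tile carries a label, and all tiles are corner congruent: the labels are arranged in the same way, up to rotation and reflection, along the boundaries of all tiles. The labels are symbols; no angle values or edge lengths are assumed. Write $\{f\,\alpha^3\beta\gamma : n_1\alpha^{k_1}, n_2\beta^{k_2}, n_3\gamma^{k_3}\}$ for the requirement that there are exactly $f$ tiles, that each tile has three corners $\alpha$, one corner $\beta$ and one corner $\gamma$ (in any arrangement, the same for all tiles), and that the vertices are exactly $n_1$ vertices at which $k_1$ corners $\alpha$ meet, $n_2$ vertices at which $k_2$ corners $\beta$ meet and $n_3$ vertices at which $k_3$ corners $\gamma$ meet. Let $$\mathrm{AVC}(3A24)=\{24\alpha^3\beta\gamma : 24\alpha^3,\,8\beta^3,\,6\gamma^4\},\qquad \mathrm{AVC}(3A60)=\{60\alpha^3\beta\gamma : 60\alpha^3,\,20\beta^3,\,12\gamma^5\}.$$ The pentagonal subdivision of a cell decomposition of an oriented surface is obtained by dividing every edge into three by two new vertices and joining the centre of every face, for every edge of the face, to the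 second of the two new vertices that are met when the edge is followed counterclockwise around the face. Each resulting pentagon has, in counterclockwise order, one corner $\epsilon$ at the centre of a face, one corner $\alpha$ at a new vertex on an edge, one corner $\delta$ at an original vertex, and two corners $\beta,\gamma$ at the two new vertices of the next edge. Let $PP_6$ and $PP_{12}$ be the pentagonal subdivisions of the cube and of the dodecahedron, labeled in this way. Their 3A reductions are obtained by the change of labels $\alpha,\beta,\gamma,\delta,\epsilon\to\alpha,\alpha,\alpha,\beta,\gamma$. Theorem. A labeled cell decomposition is a tiling for $\mathrm{AVC}(3A24)$ if and only if it is, up to an orientation preserving or reversing isomorphism that respects the labels, the 3A reduction of $PP_6$. It is a tiling for $\mathrm{AVC}(3A60)$ if and only if it is, in the same sense, the 3A reduction of $PP_{12}$. -/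

import Mathlib

namespace SphereTiling

/-- A cell decomposition of a closed oriented surface, given by its set `D` of darts (oriented
edges).  `next d` is the dart that follows `d` along the boundary of the face to the left of `d`
(counterclockwise), and `opp d` is the same edge with the opposite orientation.  A dart `d` also
stands for the corner of the face to the left of `d` at the starting point of `d`. -/
structure OrientedMap (D : Type*) where
  next : Equiv.Perm D
  opp : Equiv.Perm D
  opp_opp : ∀ d, opp (opp d) = d
  opp_ne : ∀ d, opp d ≠ d

namespace OrientedMap

variable {D : Type*} (M : OrientedMap D)

/-- The counterclockwise rotation of the darts about their starting points. -/
def rot : Equiv.Perm D := M.opp * M.next⁻¹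

/-- The faces are the cycles of `next`. -/
abbrev Face : Type _ := Quotient (Equiv.Perm.SameCycle.setoid M.next)

/-- The edges are the cycles of `opp`. -/
abbrev Edge : Type _ := Quotient (Equiv.Perm.SameCycle.setoid M.opp)

/-- The vertices are the cycles of `rot`. -/
abbrev Vertex : Type _ := Quotient (Equiv.Perm.SameCycle.setoid M.rot)

/-- The starting point of a dart. -/
def source (d : D) : M.Vertex := Quotient.mk _ d

/-- The number of corners at a vertex. -/
noncomputable def degree (v : M.Vertex) : ℕ := Nat.card {d : D // M.source d = v}

/-- The surface is connected. -/
def Connected : Prop :=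
  Nonempty D ∧ ∀ d e : D, ∃ g ∈ Subgroup.closure {M.next, M.opp}, g d = e

/-- The surface is the sphere: it is compact, connected (and oriented), of Euler
characteristic 2. -/
def IsSphere : Prop :=
  Finite D ∧ M.Connected ∧ Nat.card M.Vertex + Nat.card M.Face = Nat.card M.Edge + 2

/-- An edge-to-edge tiling of the sphere by pentagons: the boundary of every tile is a simple
closed path of five edges, and all vertices have degree at least 3. -/
def IsPentagonalTiling : Prop :=
  M.IsSphere ∧
  (∀ d : D, (M.next ^ 5) d = d ∧
    Function.Injective fun i : Fin 5 => M.source ((M.next ^ (i : ℕ)) d)) ∧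
  ∀ v : M.Vertex, 3 ≤ M.degree v

/-- The same decomposition with the orientation of the surface reversed.  A dart still stands for
the same corner. -/
def mirror : OrientedMap D where
  next := M.next⁻¹
  opp := M.next * M.opp * M.next⁻¹
  opp_opp d := by simp [M.opp_opp]
  opp_ne d := by
    intro h
    have h' : M.opp (M.next⁻¹ d) = M.next⁻¹ d := by
      apply M.next.injective
      simpa using h
    exact M.opp_ne _ h'

end OrientedMap

/-- A cell decomposition of an oriented surface with a label at every corner of every face. -/
structure LabeledMap (D L : Type*) extends OrientedMap D where
  label : D → L

/-- An anglewise vertex combination: the number of tiles, the corners of a tile, and the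
combinations of corners at the vertices, counted with multiplicity. -/
structure AVC (L : Type*) where
  tiles : ℕ
  tile : Multiset L
  vertices : Multiset (Multiset L)

namespace LabeledMap

variable {D D' L L' : Type*}

/-- All tiles are corner congruent to the pentagon with corners `w 0, …, w 4` in cyclic order:
every tile carries these labels in this cyclic order or in the reversed one. -/
def CornerCongruent (T : LabeledMap D L) (w : Fin 5 → L) : Prop :=
  ∀ d : D, ∃ k : Fin 5,
    (∀ i : Fin 5, T.label ((T.next ^ (i : ℕ)) d) = w (k + i)) ∨
    (∀ i : Fin 5, T.label ((T.next ^ (i : ℕ)) d) = w (k - i))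

open Classical in
/-- The combination of labels of the corners at a vertex. -/
noncomputable def combination [Fintype D] (T : LabeledMap D L) (v : T.Vertex) : Multiset L :=
  (Finset.univ.filter fun d : D => T.source d = v).val.map T.label

open Classical in
/-- `T` is a tiling for the anglewise vertex combination `A`. -/
def IsTilingFor [Fintype D] (T : LabeledMap D L) (A : AVC L) : Prop :=
  T.IsPentagonalTiling ∧
  Nat.card T.Face = A.tiles ∧
  (∃ w : Fin 5 → L, (Finset.univ : Finset (Fin 5)).val.map w = A.tile ∧ T.CornerCongruent w) ∧
  ∀ m : Multiset L, Nat.card {v : T.Vertex // T.combination v = m} = A.vertices.count m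

/-- The same decomposition and labels with the orientation of the surface reversed. -/
def mirror (T : LabeledMap D L) : LabeledMap D L where
  toOrientedMap := T.toOrientedMap.mirror
  label := T.label

/-- Orientation preserving isomorphism of labeled decompositions. -/
def Isomorphic (T : LabeledMap D L) (T' : LabeledMap D' L) : Prop :=
  ∃ e : D ≃ D', ∀ d, e (T.next d) = T'.next (e d) ∧ e (T.opp d) = T'.opp (e d) ∧
    T'.label (e d) = T.label d

/-- Two labeled decompositions are the same, up to a possibly orientation reversing
isomorphism. -/
def Equivalent (T : LabeledMap D L) (T' : LabeledMap D' L) : Prop :=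
  T.Isomorphic T' ∨ T.mirror.Isomorphic T'

/-- Change of labels. -/
def relabel (T : LabeledMap D L) (f : L → L') : LabeledMap D L' where
  toOrientedMap := T.toOrientedMap
  label := f ∘ T.label

end LabeledMap

/-- The symbols for the corners of a pentagon. -/
inductive Angle where
  | α | β | γ | δ | ε
  deriving DecidableEq

/-- Opposite darts in the pentagonal subdivision, see `pentagonalSubdivision`. -/
def subdivisionOpp {D : Type*} (M : OrientedMap D) : D × Fin 5 → D × Fin 5
  | (d, 0) => (M.next⁻¹ d, 4)
  | (d, 1) => (M.opp (M.next⁻¹ d), 2)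
  | (d, 2) => (M.next (M.opp d), 1)
  | (d, 3) => (M.opp d, 3)
  | (d, 4) => (M.next d, 0)

theorem subdivisionOpp_involutive {D : Type*} (M : OrientedMap D) :
    Function.Involutive (subdivisionOpp M) := by
  rintro ⟨d, i⟩
  fin_cases i <;> simp [subdivisionOpp, M.opp_opp]

/-- The pentagonal subdivision of a cell decomposition of an oriented surface.  Every edge is
divided into three by two new vertices, and the centre of every face is joined, for every edge of
the face, to the second of the two new vertices that are met when the edge is followed
counterclockwise around the face.  The tiles correspond to the corners `d` of the faces.  The
corners of the tile `d` are, counterclockwise: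
* `(d, 0)`, at the centre of the face;
* `(d, 1)`, at the second new vertex on the edge that precedes `d`;
* `(d, 2)`, at the starting point of `d`;
* `(d, 3)` and `(d, 4)`, at the first and at the second new vertex on `d`.
They are labeled `ε, α, δ, β, γ`. -/
def pentagonalSubdivision {D : Type*} (M : OrientedMap D) : LabeledMap (D × Fin 5) Angle where
  next := Equiv.prodCongr (Equiv.refl D) (Equiv.addRight 1)
  opp := (subdivisionOpp_involutive M).toPerm
  opp_opp := subdivisionOpp_involutive M
  opp_ne := by
    rintro ⟨d, i⟩
    fin_cases i <;> simp [subdivisionOpp, M.opp_ne]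
  label d := ![.ε, .α, .δ, .β, .γ] d.2

/-- The vertex of the cube `{0, 1}³` that is joined to `v` by an edge in direction `i`. -/
def cubeFlip (v : Fin 3 → Bool) (i : Fin 3) : Fin 3 → Bool := Function.update v i (!v i)

/-- The parity of the sum of the coordinates. -/
def cubeParity (v : Fin 3 → Bool) : Bool := v 0 ^^ v 1 ^^ v 2

/-- The surface of the cube `[0, 1]³`.  The dart `(v, i)` starts at the vertex `v` in the direction
of the `i`-th axis. -/
def cube : OrientedMap ((Fin 3 → Bool) × Fin 3) where
  next :=
    { toFun := fun d => (cubeFlip d.1 d.2, if cubeParity d.1 then d.2 - 1 else d.2 + 1)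
      invFun := fun d =>
        let j := if cubeParity d.1 then d.2 - 1 else d.2 + 1
        (cubeFlip d.1 j, j)
      left_inv := by unfold Function.LeftInverse; decide
      right_inv := by unfold Function.RightInverse Function.LeftInverse; decide }
  opp := Function.Involutive.toPerm (fun d => (cubeFlip d.1 d.2, d.2))
    (by unfold Function.Involutive; decide)
  opp_opp := by decide
  opp_ne := by decide

/-- Opposite darts of the dodecahedron, see `dodecahedron`. -/
def dodecahedronOpp : (Bool × Option (Fin 5)) × Fin 5 → (Bool × Option (Fin 5)) × Fin 5
  | ((s, none), k) => ((s, some k), 0)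
  | ((s, some k), 0) => ((s, none), k)
  | ((s, some k), 1) => ((s, some (k - 1)), 4)
  | ((s, some k), 2) => ((!s, some (-k)), 2)
  | ((s, some k), 3) => ((!s, some (-k - 1)), 3)
  | ((s, some k), 4) => ((s, some (k + 1)), 1)

/-- The surface of the dodecahedron.  The faces are two opposite faces `(s, none)` and, for each of
these, the five faces `(s, some k)` around it, numbered counterclockwise.  The sides of every face
are numbered `0, …, 4` counterclockwise.  Side `k` of `(s, none)` is side `0` of `(s, some k)`;
sides `1` and `4` of `(s, some k)` are shared with `(s, some (k - 1))` and `(s, some (k + 1))`, and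
sides `2` and `3` are shared with faces around the opposite face `(!s, none)`. -/
def dodecahedron : OrientedMap ((Bool × Option (Fin 5)) × Fin 5) where
  next := Equiv.prodCongr (Equiv.refl _) (Equiv.addRight 1)
  opp := Function.Involutive.toPerm dodecahedronOpp (by unfold Function.Involutive; decide)
  opp_opp := by decide
  opp_ne := by decide

/-- The reduction 3A, which identifies `α`, `β` and `γ`:
`α, β, γ, δ, ε → α, α, α, β, γ`. -/
def reduction3A : Angle → Angle
  | .α => .α
  | .β => .α
  | .γ => .α
  | .δ => .β
  | .ε => .γ

/-- The 3A reduction of the pentagonal subdivision of the cube. -/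
def PP6_3A : LabeledMap (((Fin 3 → Bool) × Fin 3) × Fin 5) Angle :=
  (pentagonalSubdivision cube).relabel reduction3A

/-- The 3A reduction of the pentagonal subdivision of the dodecahedron. -/
def PP12_3A : LabeledMap (((Bool × Option (Fin 5)) × Fin 5) × Fin 5) Angle :=
  (pentagonalSubdivision dodecahedron).relabel reduction3A

/-- `AVC(3A24) = {24α³βγ : 24α³, 8β³, 6γ⁴}` -/
def AVC3A24 : AVC Angle where
  tiles := 24
  tile := {.α, .α, .α, .β, .γ}
  vertices := Multiset.replicate 24 (Multiset.replicate 3 .α) +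
    Multiset.replicate 8 (Multiset.replicate 3 .β) +
    Multiset.replicate 6 (Multiset.replicate 4 .γ)

/-- `AVC(3A60) = {60α³βγ : 60α³, 20β³, 12γ⁵}` -/
def AVC3A60 : AVC Angle where
  tiles := 60
  tile := {.α, .α, .α, .β, .γ}
  vertices := Multiset.replicate 60 (Multiset.replicate 3 .α) +
    Multiset.replicate 20 (Multiset.replicate 3 .β) +
    Multiset.replicate 12 (Multiset.replicate 5 .γ)

end SphereTiling

/-! ### Cycles of permutations and counting in cell decompositions. -/

namespace SphereTiling

open Function

/-! All corners at a vertex carry the same label, so the vertices themselves are labeled, and the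
labels of two tiles agree along a common edge. If `β` and `γ` were adjacent in a tile, the edges at
a `β³` vertex would end alternately in `α` and `γ`, which degree 3 forbids (`not_adjacent`). Hence
the tile is `γαβαα`, a word without symmetry, so every tile has a well-defined orientation and
numbered corners.

Of the three `α` corners of a tile, one has neighbours `γ, β`, one `β, α` and one `α, γ`. At an `α³`
vertex the far ends of the three edges are therefore pairwise different, and the three tiles are one
of each kind with the same orientation (`reducedWord_vertex`). Every edge has an `α` end, so by
connectedness all tiles have the same orientation, and after a reflection it is counterclockwise.
How the numbered sides are glued is then forced (`IsIndexedBy`).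

Such a tiling is the pentagonal subdivision of its `contraction`: the darts are the `γ` corners, the
faces come from the `γᵏ` vertices and the vertices from the `β³` vertices
(`isomorphic_contraction`). The contraction is connected, with `k`-gonal faces, vertices of degree 3
and as many darts as there are tiles. For 24 darts and `k = 4` it is the cube, for 60 darts and `k =
5` the dodecahedron: explicit words in the dart permutations define an equivariant map from the
model, which is onto by connectedness and bijective by counting.

Conversely, the subdivisions satisfy the local conditions `IsReduced`, and counting corners then
gives the numbers of vertices and the Euler characteristic. -/

theorem finite_perm_inv_closed {D : Type*} [Finite D] (f : Equiv.Perm D) {P : D → Prop}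
    (h : ∀ d, P d → P (f d)) (d : D) (hd : P d) : P (f⁻¹ d) := by
  have hp : ∀ n : ℕ, P ((f ^ n) d) := by
    intro n
    induction n with
    | zero => simpa using hd
    | succ n ih => rw [pow_succ', Equiv.Perm.mul_apply]; exact h _ ih
  have : f⁻¹ = f ^ (orderOf f - 1) := by
    rw [inv_eq_iff_mul_eq_one, ← pow_succ', Nat.sub_add_cancel (orderOf_pos f), pow_orderOf_eq_one]
  rw [this]
  exact hp _

theorem card_sameCycle {D : Type*} [Finite D] (f : Equiv.Perm D) (d : D) :
    Nat.card {e : D // (Quotient.mk (Equiv.Perm.SameCycle.setoid f) e) = Quotient.mk _ d} =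
      minimalPeriod f d := by
  classical
  have := Fintype.ofFinite D
  have h := MulAction.minimalPeriod_eq_card f d
  simp only [Equiv.Perm.smul_def] at h
  rw [show minimalPeriod f d = minimalPeriod (fun x => f x) d from rfl, h, ← Nat.card_eq_fintype_card]
  refine Nat.card_congr (Equiv.subtypeEquivRight fun e => ?_)
  rw [Quotient.eq]
  change f.SameCycle e d ↔ _
  rw [Equiv.Perm.sameCycle_comm, MulAction.mem_orbit_iff]
  constructor
  · rintro ⟨i, rfl⟩
    exact ⟨⟨f ^ i, i, rfl⟩, rfl⟩
  · rintro ⟨⟨_, i, rfl⟩, rfl⟩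
    exact ⟨i, rfl⟩

theorem card_eq_mul_card_cycles {D : Type*} [Finite D] (f : Equiv.Perm D)
    (P : Quotient (Equiv.Perm.SameCycle.setoid f) → Prop) (c : ℕ)
    (h : ∀ d, P (Quotient.mk _ d) → minimalPeriod f d = c) :
    Nat.card {d : D // P (Quotient.mk _ d)} = Nat.card {q // P q} * c := by
  classical
  have := Fintype.ofFinite D
  have := Fintype.ofFinite {q // P q}
  let g : {d : D // P (Quotient.mk _ d)} → {q // P q} := fun d => ⟨Quotient.mk _ d.1, d.2⟩
  rw [← Nat.card_congr (Equiv.sigmaFiberEquiv g), Nat.card_sigma]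
  have : ∀ q : {q // P q}, Nat.card {x // g x = q} = c := by
    rintro ⟨q, hq⟩
    induction q using Quotient.inductionOn with
    | h d =>
      rw [← h d hq, ← card_sameCycle]
      refine Nat.card_congr
        { toFun := fun x => ⟨x.1.1, congrArg Subtype.val x.2⟩
          invFun := fun e => ⟨⟨e.1, by rw [e.2]; exact hq⟩, Subtype.ext e.2⟩
          left_inv := fun _ => rfl
          right_inv := fun _ => rfl }
  rw [Finset.sum_congr rfl fun q _ => this q]
  simp

theorem minimalPeriod_conj {D D' : Type*} {e : D → D'} (he : Injective e) {f : D → D} {f' : D' → D'}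
    (h : ∀ d, e (f d) = f' (e d)) (d : D) : minimalPeriod f' (e d) = minimalPeriod f d := by
  have hs : Semiconj e f f' := h
  refine minimalPeriod_eq_minimalPeriod_iff.2 fun n => ?_
  simp only [IsPeriodicPt, IsFixedPt, ← (hs.iterate_right n).eq, he.eq_iff]

theorem minimalPeriod_inv {D : Type*} (f : Equiv.Perm D) (d : D) :
    minimalPeriod (⇑f⁻¹) d = minimalPeriod f d := by
  refine minimalPeriod_eq_minimalPeriod_iff.2 fun n => ?_
  simp only [IsPeriodicPt, IsFixedPt, ← Equiv.Perm.coe_pow, inv_pow, Equiv.Perm.inv_eq_iff_eq]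
  exact eq_comm

theorem sameCycle_conj {D D' : Type*} (e : D ≃ D') {f : Equiv.Perm D} {f' : Equiv.Perm D'}
    (h : ∀ d, e (f d) = f' (e d)) (x y : D) : f'.SameCycle (e x) (e y) ↔ f.SameCycle x y := by
  have : f' = (e.symm.trans f).trans e := by
    ext z
    simp [h]
  have hz : ∀ i : ℤ, (f' ^ i) (e x) = e ((f ^ i) x) := by
    intro i
    have hn : ∀ (n : ℕ) x, (f' ^ n) (e x) = e ((f ^ n) x) := by
      intro n x
      induction n generalizing x with
      | zero => rfl
      | succ n ih => rw [pow_succ, pow_succ, Equiv.Perm.mul_apply, Equiv.Perm.mul_apply, ← h, ih]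
    cases i with
    | ofNat n => exact hn n x
    | negSucc n =>
      rw [zpow_negSucc, zpow_negSucc, Equiv.Perm.inv_eq_iff_eq, hn]
      simp
  exact exists_congr fun i => by rw [hz, e.injective.eq_iff]

theorem sameCycle_eq_of_apply_three {D : Type*} {f : Equiv.Perm D} {x y : D}
    (h : f.SameCycle x y) (hx : f (f (f x)) = x) : y = x ∨ y = f x ∨ y = f (f x) := by
  obtain ⟨i, rfl⟩ := h
  have h3 : ∀ j : ℤ, (f ^ (3 * j)) x = x := by
    intro j
    rw [zpow_mul]
    apply Equiv.Perm.zpow_apply_eq_self_of_apply_eq_self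
    exact hx
  have hi : i = i % 3 + 3 * (i / 3) := (Int.emod_add_mul_ediv i 3).symm
  rw [hi, zpow_add, Equiv.Perm.mul_apply, h3]
  have h1 := Int.emod_nonneg i (by norm_num : (3 : ℤ) ≠ 0)
  have h2 := Int.emod_lt_of_pos i (by norm_num : (0 : ℤ) < 3)
  generalize i % 3 = j at *
  interval_cases j
  · left; rfl
  · right; left; rfl
  · right; right; rfl

namespace OrientedMap

variable {D D' : Type*}

/-- On a finite set inverses are positive powers, so closure under `next` and `opp` is enough. In
this form connectedness is an induction principle that spreads a property from one dart to all. -/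
theorem connected_iff [Finite D] (M : OrientedMap D) : M.Connected ↔
    Nonempty D ∧ ∀ P : D → Prop, (∀ d, P d → P (M.next d)) → (∀ d, P d → P (M.opp d)) →
      ∀ d e, P d → P e := by
  refine and_congr_right fun _ => ⟨fun h P hn ho d e hd => ?_, fun h d e => ?_⟩
  · obtain ⟨g, hg, rfl⟩ := h d e
    have key : ∀ d, P d → P (g d) ∧ P (g⁻¹ d) := by
      induction hg using Subgroup.closure_induction with
      | mem x hx =>
        rcases hx with rfl | rfl
        · exact fun d hd => ⟨hn d hd, finite_perm_inv_closed _ hn d hd⟩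
        · exact fun d hd => ⟨ho d hd, finite_perm_inv_closed _ ho d hd⟩
      | one => exact fun d hd => ⟨hd, by simpa using hd⟩
      | mul x y _ _ hx hy =>
        intro d hd
        refine ⟨(hx _ (hy _ hd).1).1, ?_⟩
        rw [mul_inv_rev]
        exact (hy _ (hx _ hd).2).2
      | inv x _ hx => exact fun d hd => ⟨(hx d hd).2, by simpa using (hx d hd).1⟩
    exact (key d hd).1
  · refine h (fun e => ∃ g ∈ Subgroup.closure {M.next, M.opp}, g d = e) ?_ ?_ d e
      ⟨1, one_mem _, rfl⟩
    · rintro _ ⟨g, hg, rfl⟩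
      exact ⟨M.next * g, mul_mem (Subgroup.subset_closure (by simp)) hg, rfl⟩
    · rintro _ ⟨g, hg, rfl⟩
      exact ⟨M.opp * g, mul_mem (Subgroup.subset_closure (by simp)) hg, rfl⟩

theorem source_eq_source (M : OrientedMap D) {x y : D} :
    M.source x = M.source y ↔ M.rot.SameCycle x y := Quotient.eq

theorem rot_apply (M : OrientedMap D) (d : D) : M.rot d = M.opp (M.next⁻¹ d) := rfl

theorem next_next_inv (M : OrientedMap D) (d : D) : M.next (M.next⁻¹ d) = d :=
  M.next.apply_symm_apply d

theorem next_inv_next (M : OrientedMap D) (d : D) : M.next⁻¹ (M.next d) = d :=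
  M.next.symm_apply_apply d

theorem opp_eq_rot_next (M : OrientedMap D) (d : D) : M.opp d = M.rot (M.next d) := by
  simp [rot_apply]

theorem opp_inv (M : OrientedMap D) : M.opp⁻¹ = M.opp := by
  ext d
  rw [Equiv.Perm.inv_eq_iff_eq, M.opp_opp]

theorem source_rot (M : OrientedMap D) (d : D) : M.source (M.rot d) = M.source d :=
  M.source_eq_source.2 (Equiv.Perm.sameCycle_apply_left.2 (Equiv.Perm.SameCycle.refl _ _))

theorem degree_source [Finite D] (M : OrientedMap D) (d : D) :
    M.degree (M.source d) = minimalPeriod M.rot d :=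
  card_sameCycle M.rot d

theorem rot_mirror (M : OrientedMap D) : M.mirror.rot = M.rot⁻¹ := by
  simp only [rot, mirror, mul_inv_rev, inv_inv, opp_inv]
  group

theorem two_mul_card_edge [Finite D] (M : OrientedMap D) : Nat.card M.Edge * 2 = Nat.card D := by
  have h := card_eq_mul_card_cycles M.opp (fun _ => True) 2 fun d _ => by
    have : Fact (Nat.Prime 2) := ⟨Nat.prime_two⟩
    exact minimalPeriod_eq_prime (M.opp_opp d) (M.opp_ne d)
  rw [← Nat.card_congr (Equiv.subtypeUnivEquiv fun _ : M.Edge => trivial), ← h]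
  exact Nat.card_congr (Equiv.subtypeUnivEquiv fun _ => trivial)

theorem five_mul_card_face [Finite D] (M : OrientedMap D) (h5 : ∀ d, (M.next ^ 5) d = d)
    (h1 : ∀ d, M.next d ≠ d) : Nat.card M.Face * 5 = Nat.card D := by
  have h := card_eq_mul_card_cycles M.next (fun _ => True) 5 fun d _ => by
    have : Fact (Nat.Prime 5) := ⟨Nat.prime_five⟩
    exact minimalPeriod_eq_prime (h5 d) (h1 d)
  rw [← Nat.card_congr (Equiv.subtypeUnivEquiv fun _ : M.Face => trivial), ← h]
  exact Nat.card_congr (Equiv.subtypeUnivEquiv fun _ => trivial)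

end OrientedMap

end SphereTiling

/-! ### Tilings with one label per vertex, reduced to local conditions on darts. -/

namespace SphereTiling

open Function

/-- The number of corners at a vertex with the given label. -/
def cornerOrder (k : ℕ) : Angle → ℕ
  | .γ => k
  | _ => 3

/-- The combination of corners `α³` at `a` vertices, `β³` at `b` vertices and `γᵏ` at `c` vertices,
with `a` tiles. -/
def reducedAVC (a b c k : ℕ) : AVC Angle where
  tiles := a
  tile := {.α, .α, .α, .β, .γ}
  vertices := Multiset.replicate a (Multiset.replicate 3 .α) +
    Multiset.replicate b (Multiset.replicate 3 .β) +
    Multiset.replicate c (Multiset.replicate k .γ)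

namespace LabeledMap

variable {D D' : Type*}

/-- Pentagonal tilings with `n` tiles `α³βγ` in which all corners at a vertex have the same label
and the vertices are `α³`, `β³` and `γᵏ`, described on darts. -/
structure IsReduced (T : LabeledMap D Angle) (n k : ℕ) : Prop where
  connected : T.Connected
  card : Nat.card D = 5 * n
  next_pow : ∀ d, (T.next ^ 5) d = d
  simple : ∀ d, Injective fun i : Fin 5 => T.source ((T.next ^ (i : ℕ)) d)
  congruent : ∃ w : Fin 5 → Angle, (Finset.univ : Finset (Fin 5)).val.map w =
    {.α, .α, .α, .β, .γ} ∧ T.CornerCongruent w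
  label_rot : ∀ d, T.label (T.rot d) = T.label d
  period : ∀ d, minimalPeriod T.rot d = cornerOrder k (T.label d)

theorem card_combination {L : Type*} [Fintype D] (T : LabeledMap D L) (v : T.Vertex) :
    Multiset.card (T.combination v) = T.degree v := by
  classical
  rw [combination, Multiset.card_map, OrientedMap.degree, Nat.card_eq_fintype_card,
    Fintype.card_subtype]
  simp only [Finset.card_val]

theorem mem_combination {L : Type*} [Fintype D] (T : LabeledMap D L) (v : T.Vertex) (l : L) :
    l ∈ T.combination v ↔ ∃ d, T.source d = v ∧ T.label d = l := by
  simp [combination]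

/-- Double counting of pairs of a dart and a step number `i < 5`. From each dart the five steps run
through the whole tile, and for each fixed `i` the step is a permutation of the darts. -/
theorem card_label [Fintype D] (T : LabeledMap D Angle) {n : ℕ}
    (hcard : Nat.card D = 5 * n) {w : Fin 5 → Angle} {t : Multiset Angle}
    (hw : (Finset.univ : Finset (Fin 5)).val.map w = t) (hc : T.CornerCongruent w) (a : Angle) :
    Nat.card {d // T.label d = a} = n * t.count a := by
  classical
  have h1 : ∀ d, ∑ i : Fin 5, (if T.label ((T.next ^ (i : ℕ)) d) = a then 1 else 0) =
      t.count a := by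
    intro d
    have h2 : t.count a = ∑ i : Fin 5, if w i = a then 1 else 0 := by
      rw [← hw, Multiset.count_map, Finset.sum_boole]
      simp only [Finset.card_def, Finset.filter_val, Nat.cast_id, eq_comm]
    rw [h2]
    obtain ⟨k, h | h⟩ := hc d
    · simp only [h]
      exact Equiv.sum_comp (Equiv.addLeft k) fun i => if w i = a then 1 else 0
    · simp only [h]
      exact Equiv.sum_comp (Equiv.subLeft k) fun i => if w i = a then 1 else 0
  have h3 : ∑ d, ∑ i : Fin 5, (if T.label ((T.next ^ (i : ℕ)) d) = a then 1 else 0) =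
      5 * n * t.count a := by
    rw [Finset.sum_congr rfl fun d _ => h1 d]
    simp [← hcard]
  rw [Finset.sum_comm] at h3
  have h4 : ∀ i : Fin 5, ∑ d, (if T.label ((T.next ^ (i : ℕ)) d) = a then 1 else 0) =
      Nat.card {d // T.label d = a} := by
    intro i
    rw [Equiv.sum_comp (T.next ^ (i : ℕ)) fun d => if T.label d = a then 1 else 0,
      Nat.card_eq_fintype_card, Fintype.card_subtype, Finset.sum_boole, Nat.cast_id]
  rw [Finset.sum_congr rfl fun i _ => h4 i] at h3
  simp only [Finset.sum_const, Finset.card_univ, Fintype.card_fin, smul_eq_mul] at h3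
  rw [mul_assoc] at h3
  exact Nat.eq_of_mul_eq_mul_left (by norm_num) h3

theorem label_eq_of_source_eq [Finite D] {L : Type*} (T : LabeledMap D L)
    (h : ∀ d, T.label (T.rot d) = T.label d) {d e : D} (hde : T.source d = T.source e) :
    T.label d = T.label e := by
  obtain ⟨i, rfl⟩ := (T.source_eq_source.1 hde).exists_nat_pow_eq
  clear hde
  induction i with
  | zero => rfl
  | succ i ih => rw [pow_succ', Equiv.Perm.mul_apply, h, ← ih]

theorem replicate_cornerOrder_inj {k : ℕ} (hk : 3 ≤ k) {a b : Angle}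
    (h : Multiset.replicate (cornerOrder k a) a = Multiset.replicate (cornerOrder k b) b) :
    a = b := by
  have ha : a ∈ Multiset.replicate (cornerOrder k a) a :=
    Multiset.mem_replicate.2 ⟨by cases a <;> simp [cornerOrder]; omega, rfl⟩
  rw [h] at ha
  exact (Multiset.mem_replicate.1 ha).2

theorem IsTilingFor.isReduced [Fintype D] {T : LabeledMap D Angle} {a b c k : ℕ}
    (h : T.IsTilingFor (reducedAVC a b c k)) : T.IsReduced a k := by
  obtain ⟨⟨⟨-, hconn, -⟩, hface, -⟩, hcard, hw, hv⟩ := h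
  have hv' : ∀ m, Nat.card {v : T.Vertex // T.combination v = m} =
      (reducedAVC a b c k).vertices.count m := by
    intro m
    convert hv m
  have hcomb : ∀ d, T.combination (T.source d) =
      Multiset.replicate (cornerOrder k (T.label d)) (T.label d) := by
    intro d
    -- A combination that occurs has positive count, so it is one of the three prescribed ones; the
    -- label of `d` tells which.
    have hpos : T.combination (T.source d) ∈ (reducedAVC a b c k).vertices := by
      have : Nonempty {v : T.Vertex // T.combination v = T.combination (T.source d)} := ⟨⟨_, rfl⟩⟩
      exact Multiset.count_pos.1 (lt_of_lt_of_eq Nat.card_pos (hv' _))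
    have hl := (T.mem_combination (T.source d) (T.label d)).2 ⟨d, rfl, rfl⟩
    simp only [reducedAVC, Multiset.mem_add, Multiset.mem_replicate] at hpos
    rcases hpos with (⟨-, h⟩ | ⟨-, h⟩) | ⟨-, h⟩ <;> rw [h] at hl ⊢ <;>
      rw [(Multiset.mem_replicate.1 hl).2] <;> rfl
  refine ⟨hconn, ?_, fun d => (hface d).1, fun d => (hface d).2, hw, fun d => ?_, fun d => ?_⟩
  · rw [← T.five_mul_card_face (fun d => (hface d).1), hcard, mul_comm]
    · rfl
    intro d hd
    have := @(hface d).2 0 1 (by simp [hd])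
    exact absurd this (by decide)
  · have := (T.mem_combination (T.source d) (T.label (T.rot d))).2 ⟨_, T.source_rot d, rfl⟩
    rw [hcomb] at this
    exact (Multiset.mem_replicate.1 this).2
  · rw [← T.degree_source, ← T.card_combination, hcomb, Multiset.card_replicate]

/-- Counting the corners with a given label by tiles and by vertices yields `n`, `b` and `c`
vertices of the three kinds. Since there are `n` faces and `5n/2` edges, `he` is Euler's relation
cleared of its denominator. -/
theorem IsReduced.isTilingFor [Fintype D] {T : LabeledMap D Angle} {n b c k : ℕ}
    (h : T.IsReduced n k) (hk : 3 ≤ k) (hb : b * 3 = n) (hc : c * k = n)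
    (he : 2 * (2 * n + b + c) = 5 * n + 4) :
    T.IsTilingFor (reducedAVC n b c k) := by
  classical
  obtain ⟨w, hw, hcong⟩ := h.congruent
  have hface : Nat.card T.Face = n := by
    have := T.five_mul_card_face h.next_pow fun d hd => by
      have := @h.simple d 0 1 (by simp [hd])
      exact absurd this (by decide)
    rw [h.card] at this
    omega
  have hcomb : ∀ d, T.combination (T.source d) =
      Multiset.replicate (cornerOrder k (T.label d)) (T.label d) := by
    intro d
    rw [Multiset.eq_replicate, T.card_combination, T.degree_source, h.period]
    refine ⟨rfl, fun l hl => ?_⟩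
    obtain ⟨e, he, rfl⟩ := (T.mem_combination _ _).1 hl
    exact T.label_eq_of_source_eq h.label_rot he
  have hiff : ∀ d x, T.combination (T.source d) = Multiset.replicate (cornerOrder k x) x ↔
      T.label d = x := by
    intro d x
    rw [hcomb]
    exact ⟨replicate_cornerOrder_inj hk, fun hx => by rw [hx]⟩
  have hcount : ∀ x, Nat.card {v : T.Vertex // T.combination v =
      Multiset.replicate (cornerOrder k x) x} * cornerOrder k x =
      n * Multiset.count x ({.α, .α, .α, .β, .γ} : Multiset Angle) := by
    intro x
    rw [← T.card_label h.card hw hcong x, ← card_eq_mul_card_cycles T.rot _ _ fun d hd => by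
      rw [h.period d, (hiff d x).1 hd]]
    exact Nat.card_congr (Equiv.subtypeEquivRight fun d => hiff d x)
  have hα : Nat.card {v : T.Vertex // T.combination v = Multiset.replicate 3 .α} = n := by
    have := hcount .α
    change Nat.card {v : T.Vertex // T.combination v = Multiset.replicate 3 .α} * 3 = n * 3 at this
    omega
  have hβ : Nat.card {v : T.Vertex // T.combination v = Multiset.replicate 3 .β} = b := by
    have := hcount .β
    change Nat.card {v : T.Vertex // T.combination v = Multiset.replicate 3 .β} * 3 = n * 1 at this
    omega
  have hγ : Nat.card {v : T.Vertex // T.combination v = Multiset.replicate k .γ} = c := by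
    have := hcount .γ
    change Nat.card {v : T.Vertex // T.combination v = Multiset.replicate k .γ} * k = n * 1 at this
    rw [mul_one, ← hc] at this
    exact Nat.eq_of_mul_eq_mul_right (by omega) this
  have hαβ : Multiset.replicate 3 Angle.α ≠ Multiset.replicate 3 .β := fun h =>
    absurd (replicate_cornerOrder_inj hk (a := .α) (b := .β) h) (by decide)
  have hαγ : Multiset.replicate 3 Angle.α ≠ Multiset.replicate k .γ := fun h =>
    absurd (replicate_cornerOrder_inj hk (a := .α) (b := .γ) h) (by decide)
  have hβγ : Multiset.replicate 3 Angle.β ≠ Multiset.replicate k .γ := fun h =>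
    absurd (replicate_cornerOrder_inj hk (a := .β) (b := .γ) h) (by decide)
  have hmem : ∀ v : T.Vertex, T.combination v = Multiset.replicate 3 .α ∨
      T.combination v = Multiset.replicate 3 .β ∨ T.combination v = Multiset.replicate k .γ := by
    intro v
    induction v using Quotient.inductionOn with
    | h d =>
      have hd : ∃ i : Fin 5, T.label d = w i := by
        obtain ⟨i, h | h⟩ := hcong d
        · exact ⟨_, h 0⟩
        · exact ⟨_, h 0⟩
      obtain ⟨i, hi⟩ := hd
      have : T.label d ∈ ({.α, .α, .α, .β, .γ} : Multiset Angle) := by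
        rw [← hw, hi]
        exact Multiset.mem_map_of_mem _ (Finset.mem_univ_val _)
      have hd := hcomb d
      change T.combination (T.source d) = _ ∨ T.combination (T.source d) = _ ∨
        T.combination (T.source d) = _
      rw [hd]
      cases hl : T.label d <;> simp [hl, cornerOrder] at this ⊢
  have hV : Nat.card T.Vertex = n + b + c := by
    have := Fintype.ofFinite T.Vertex
    rw [Nat.card_eq_fintype_card, ← Finset.card_univ,
      Finset.card_eq_sum_card_fiberwise (f := fun v => T.combination v)
        (t := {Multiset.replicate 3 .α, Multiset.replicate 3 .β, Multiset.replicate k .γ})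
        (fun v _ => by simpa using hmem v),
      Finset.sum_insert (by
        simp only [Finset.mem_insert, Finset.mem_singleton, not_or]
        exact ⟨hαβ, hαγ⟩),
      Finset.sum_insert (by simpa only [Finset.mem_singleton] using hβγ),
      Finset.sum_singleton]
    simp only [← Fintype.card_subtype, ← Nat.card_eq_fintype_card]
    rw [hα, hβ, hγ, add_assoc]
  refine ⟨⟨⟨inferInstance, h.connected, ?_⟩, fun d => ⟨h.next_pow d, h.simple d⟩, fun v => ?_⟩,
    hface, ⟨w, hw, hcong⟩, fun m => ?_⟩
  · have := T.two_mul_card_edge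
    rw [h.card] at this
    rw [hV, hface]
    omega
  · induction v using Quotient.inductionOn with
    | h d =>
      have := T.degree_source d
      rw [h.period] at this
      change 3 ≤ T.degree (T.source d)
      rw [this]
      cases T.label d <;> simp [cornerOrder, hk]
  · simp only [reducedAVC, Multiset.count_add, Multiset.count_replicate]
    by_cases h1 : m = Multiset.replicate 3 .α
    · subst h1
      rw [hα, if_pos rfl, if_neg hαβ.symm, if_neg hαγ.symm, add_zero, add_zero]
    by_cases h2 : m = Multiset.replicate 3 .β
    · subst h2
      rw [hβ, if_neg hαβ, if_pos rfl, if_neg hβγ.symm, zero_add, add_zero]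
    by_cases h3 : m = Multiset.replicate k .γ
    · subst h3
      rw [hγ, if_neg hαγ, if_neg hβγ, if_pos rfl, zero_add, zero_add]
    rw [if_neg (Ne.symm h1), if_neg (Ne.symm h2), if_neg (Ne.symm h3), Nat.card_eq_zero]
    left
    refine ⟨fun v => ?_⟩
    rcases hmem v.1 with h | h | h <;> rw [v.2] at h <;> contradiction

theorem mirror_next_pow {L : Type*} (T : LabeledMap D L) (h5 : ∀ d, (T.next ^ 5) d = d)
    (i : Fin 5) (d : D) : (T.mirror.next ^ (i : ℕ)) d = (T.next ^ ((-i : Fin 5) : ℕ)) d := by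
  change ((T.next⁻¹) ^ (i : ℕ)) d = _
  rw [inv_pow, Equiv.Perm.inv_eq_iff_eq, ← Equiv.Perm.mul_apply, ← pow_add]
  fin_cases i
  · rfl
  all_goals exact (h5 d).symm

theorem CornerCongruent.mirror {L : Type*} {T : LabeledMap D L} {w : Fin 5 → L}
    (h5 : ∀ d, (T.next ^ 5) d = d)
    (h : T.CornerCongruent w) : T.mirror.CornerCongruent w := by
  have hinv := T.mirror_next_pow h5
  intro d
  obtain ⟨k, h | h⟩ := h d
  · refine ⟨k, Or.inr fun i => ?_⟩
    rw [hinv, sub_eq_add_neg, ← h]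
    rfl
  · refine ⟨k, Or.inl fun i => ?_⟩
    rw [hinv, ← sub_neg_eq_add, ← h]
    rfl

theorem IsReduced.mirror [Finite D] {T : LabeledMap D Angle} {n k : ℕ} (h : T.IsReduced n k) :
    T.mirror.IsReduced n k := by
  have hrot : T.mirror.rot = T.rot⁻¹ := T.rot_mirror
  have hlab : T.mirror.label = T.label := rfl
  have hnext : T.mirror.next = T.next⁻¹ := rfl
  have hsrc : ∀ x y, T.mirror.source x = T.mirror.source y ↔ T.source x = T.source y := by
    intro x y
    rw [OrientedMap.source_eq_source, OrientedMap.source_eq_source, hrot,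
      Equiv.Perm.sameCycle_inv]
  have hinv := T.mirror_next_pow h.next_pow
  obtain ⟨w, hw, hc⟩ := h.congruent
  refine ⟨?_, h.card, fun d => ?_, fun d i j hij => ?_, ⟨w, hw, hc.mirror h.next_pow⟩,
    fun d => ?_, fun d => ?_⟩
  · have hconn := (T.connected_iff).1 h.connected
    refine (OrientedMap.connected_iff _).2 ⟨hconn.1, fun P hn ho => hconn.2 P ?_ ?_⟩
    · intro d hd
      have := finite_perm_inv_closed _ hn d hd
      rwa [hnext, inv_inv] at this
    · intro d hd
      -- `T.opp` is the composite of `T.next`, the mirrored `opp` and the mirrored `next`, applied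
      -- in this order.
      have h1 : P (T.next d) := by
        have := finite_perm_inv_closed _ hn d hd
        rwa [hnext, inv_inv] at this
      have h2 := hn _ (ho _ h1)
      change P (T.next⁻¹ ((T.next * T.opp * T.next⁻¹) (T.next d))) at h2
      simpa using h2
  · rw [hnext, inv_pow, Equiv.Perm.inv_eq_iff_eq, h.next_pow]
  · have := (hsrc _ _).1 hij
    rw [hinv, hinv] at this
    exact neg_injective (h.simple d this)
  · rw [hlab, hrot, ← h.label_rot]
    simp
  · rw [hrot, minimalPeriod_inv, h.period, hlab]

theorem IsReduced.of_isomorphic [Finite D] {T : LabeledMap D Angle} {T' : LabeledMap D' Angle}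
    {n k : ℕ} (h : T'.IsReduced n k) (hi : T.Isomorphic T') : T.IsReduced n k := by
  obtain ⟨e, he⟩ := hi
  have : Finite D' := Finite.of_equiv _ e
  have hn : ∀ d, e (T.next d) = T'.next (e d) := fun d => (he d).1
  have ho : ∀ d, e (T.opp d) = T'.opp (e d) := fun d => (he d).2.1
  have hl : ∀ d, T'.label (e d) = T.label d := fun d => (he d).2.2
  have hr : ∀ d, e (T.rot d) = T'.rot (e d) := by
    intro d
    rw [OrientedMap.rot_apply, OrientedMap.rot_apply, ho]
    congr 1
    rw [Equiv.Perm.eq_inv_iff_eq, ← hn]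
    simp
  have hp : ∀ (i : ℕ) d, e ((T.next ^ i) d) = (T'.next ^ i) (e d) := by
    intro i d
    induction i with
    | zero => rfl
    | succ i ih => rw [pow_succ', pow_succ', Equiv.Perm.mul_apply, Equiv.Perm.mul_apply, hn, ih]
  have hsrc : ∀ x y, T'.source (e x) = T'.source (e y) ↔ T.source x = T.source y := by
    intro x y
    rw [OrientedMap.source_eq_source, OrientedMap.source_eq_source, sameCycle_conj e hr]
  obtain ⟨w, hw, hc⟩ := h.congruent
  refine ⟨?_, (Nat.card_congr e).trans h.card, fun d => ?_, fun d i j hij => ?_, ⟨w, hw, ?_⟩,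
    fun d => ?_, fun d => ?_⟩
  · have hconn := (T'.connected_iff).1 h.connected
    refine (OrientedMap.connected_iff _).2 ⟨hconn.1.map e.symm, fun P hPn hPo d d' hd => ?_⟩
    have := hconn.2 (fun x => P (e.symm x)) (fun x hx => ?_) (fun x hx => ?_) (e d) (e d')
      (by simpa using hd)
    · simpa using this
    · have := hPn _ hx
      rwa [show T.next (e.symm x) = e.symm (T'.next x) by
        rw [Equiv.eq_symm_apply, hn, e.apply_symm_apply]] at this
    · have := hPo _ hx
      rwa [show T.opp (e.symm x) = e.symm (T'.opp x) by
        rw [Equiv.eq_symm_apply, ho, e.apply_symm_apply]] at this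
  · exact e.injective (by rw [hp, h.next_pow])
  · refine h.simple (e d) ?_
    simpa only [← hp, hsrc] using hij
  · intro d
    simpa only [← hp, hl] using hc (e d)
  · rw [← hl, hr, h.label_rot, hl]
  · rw [← minimalPeriod_conj e.injective hr, h.period, hl]

end LabeledMap

end SphereTiling

/-! ### Rigidity of the labels: the tile, its orientation and the gluing. -/

namespace SphereTiling

open Function

/-- The cyclic arrangement of the corners of a tile in which `β` and `γ` are not adjacent. -/
def reducedWord : Fin 5 → Angle := ![.γ, .α, .β, .α, .α]

/-- The cyclic arrangement of the corners of a tile in which `β` and `γ` are adjacent. -/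
def adjacentWord : Fin 5 → Angle := ![.γ, .β, .α, .α, .α]

/-- The corner of a tile reached from `i` after `j` steps in the direction `s`. -/
def turn (s : Bool) (i j : Fin 5) : Fin 5 := if s then i + j else i - j

/-- The number of the dart of a tile to which a dart is opposite. -/
def oppIndex : Fin 5 → Fin 5 := ![4, 2, 1, 3, 0]

/-- From `γ` the corner `β` is two steps away in one direction and three in the other, so the word
has no rotation or reflection symmetry. -/
theorem reducedWord_turn_injective : ∀ (i i' : Fin 5) (s s' : Bool),
    (∀ j, reducedWord (turn s i j) = reducedWord (turn s' i' j)) → i = i' ∧ s = s' := by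
  decide

set_option synthInstance.maxHeartbeats 200000 in
set_option synthInstance.maxSize 2000 in
set_option maxRecDepth 4000 in
-- This is the situation at an `α³` vertex: the hypotheses match the far ends of the three edges
-- seen from both sides. The corners 1, 3, 4 have (previous, next) neighbours `(γ, β)`, `(β, α)`,
-- `(α, γ)`. The far ends are therefore pairwise distinct, and their cyclic order fixes one
-- direction for all three tiles. The entries 0 and 2 of the vector play no role, as `i` is an `α`
-- position.
theorem reducedWord_vertex : ∀ (s s' s'' : Bool) (i : Fin 5), reducedWord i = .α →
    ∀ i', reducedWord i' = .α → reducedWord (turn s' i' 1) = reducedWord (turn s i 4) →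
    ∀ i'', reducedWord i'' = .α → reducedWord (turn s'' i'' 1) = reducedWord (turn s' i' 4) →
    reducedWord (turn s i 1) = reducedWord (turn s'' i'' 4) →
    s' = s ∧ (s = true → i' = ![0, 4, 2, 1, 3] i) := by
  decide

/-- Up to rotation and reflection the word depends only on the cyclic distance of `β` from `γ`,
which is 1 or 2. -/
theorem word_classification {w : Fin 5 → Angle}
    (hw : (Finset.univ : Finset (Fin 5)).val.map w = {.α, .α, .α, .β, .γ}) :
    ∃ (c : Fin 5) (s : Bool),
      (∀ i, w i = reducedWord (turn s c i)) ∨ (∀ i, w i = adjacentWord (turn s c i)) := by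
  have hone : ∀ a, Multiset.count a ({.α, .α, .α, .β, .γ} : Multiset Angle) = 1 →
      ∃ i, ∀ j, w j = a ↔ j = i := by
    intro a ha
    rw [← hw, Multiset.count_map] at ha
    obtain ⟨i, hi⟩ := Finset.card_eq_one.1
      (show (Finset.univ.filter fun i => a = w i).card = 1 from ha)
    refine ⟨i, fun j => ?_⟩
    have := Finset.ext_iff.1 hi j
    simpa [eq_comm] using this
  obtain ⟨j, hj⟩ := hone .γ (by decide)
  obtain ⟨e, he⟩ := hone .β (by decide)
  have hje : j ≠ e := by
    rintro rfl
    have := ((hj j).2 rfl).symm.trans ((he j).2 rfl)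
    contradiction
  have hform : ∀ i, w i = if i = j then .γ else if i = e then .β else .α := by
    intro i
    split_ifs with h1 h2
    · exact (hj i).2 h1
    · exact (he i).2 h2
    · have : w i ∈ ({.α, .α, .α, .β, .γ} : Multiset Angle) := by
        rw [← hw]
        exact Multiset.mem_map_of_mem _ (Finset.mem_univ_val _)
      rw [← hj] at h1
      rw [← he] at h2
      simpa [h1, h2] using this
  simp only [hform]
  clear hform hj he hone hw
  revert j e
  decide

theorem turn_turn : ∀ (s t : Bool) (c k i : Fin 5),
    turn s c (turn t k i) = turn (s == t) (turn s c k) i := by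
  decide

namespace LabeledMap

variable {D : Type*}

theorem cornerCongruent_iff {L : Type*} (T : LabeledMap D L) (w : Fin 5 → L) :
    T.CornerCongruent w ↔
      ∀ d, ∃ i s, ∀ j : Fin 5, T.label ((T.next ^ (j : ℕ)) d) = w (turn s i j) := by
  refine forall_congr' fun d => exists_congr fun i => ?_
  simp only [Bool.exists_bool, turn]
  exact or_comm

theorem CornerCongruent.congr_turn {L : Type*} {T : LabeledMap D L} {w p : Fin 5 → L}
    (h : T.CornerCongruent w) {c : Fin 5} {s : Bool} (hp : ∀ i, w i = p (turn s c i)) :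
    T.CornerCongruent p := by
  rw [cornerCongruent_iff] at h ⊢
  intro d
  obtain ⟨i, t, hi⟩ := h d
  exact ⟨turn s c i, s == t, fun j => by rw [hi, hp, turn_turn]⟩

/-- The dart `d` is at the corner `i` of its tile, numbered as in `reducedWord` in the direction
`s`. -/
def IsAt (T : LabeledMap D Angle) (d : D) (i : Fin 5) (s : Bool) : Prop :=
  ∀ j : Fin 5, T.label ((T.next ^ (j : ℕ)) d) = reducedWord (turn s i j)

theorem IsAt.unique {T : LabeledMap D Angle} {d : D} {i i' : Fin 5} {s s' : Bool}
    (h : T.IsAt d i s) (h' : T.IsAt d i' s') : i = i' ∧ s = s' :=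
  reducedWord_turn_injective i i' s s' fun j => (h j).symm.trans (h' j)

namespace IsReduced

variable {T : LabeledMap D Angle} {n k : ℕ}

/-- Both corners lie at the end point of `d`. -/
theorem label_opp (h : T.IsReduced n k) (d : D) : T.label (T.opp d) = T.label (T.next d) := by
  rw [T.opp_eq_rot_next, h.label_rot]

theorem next_inv_apply (h : T.IsReduced n k) (d : D) : T.next⁻¹ d = (T.next ^ 4) d := by
  rw [Equiv.Perm.inv_eq_iff_eq, ← Equiv.Perm.mul_apply, ← pow_succ', h.next_pow]

/-- The edge of `T.rot d` is the side that precedes `d` in its tile, so its far end is the corner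
before `d`. -/
theorem label_next_rot (h : T.IsReduced n k) (d : D) :
    T.label (T.next (T.rot d)) = T.label ((T.next ^ 4) d) := by
  rw [← h.label_opp, T.rot_apply, T.opp_opp, h.next_inv_apply]

theorem rot_rot_rot (h : T.IsReduced n k) (d : D) (hd : cornerOrder k (T.label d) = 3) :
    T.rot (T.rot (T.rot d)) = d := by
  have := h.period d
  rw [hd] at this
  have h3 := isPeriodicPt_minimalPeriod T.rot d
  rw [this] at h3
  exact h3

/-- Each `β` corner would lie between an edge ending in `α` and an edge ending in `γ`. The two kinds
would alternate around the vertex, which is impossible for three edges. -/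
theorem not_adjacent (h : T.IsReduced n k) : ¬ T.CornerCongruent adjacentWord := by
  rw [cornerCongruent_iff]
  intro hc
  have key : ∀ d, T.label d = .β →
      (T.label (T.next d) = .α ∧ T.label (T.next (T.rot d)) = .γ) ∨
      (T.label (T.next d) = .γ ∧ T.label (T.next (T.rot d)) = .α) := by
    intro d hd
    obtain ⟨i, s, hi⟩ := hc d
    rw [h.label_next_rot]
    have h0 : T.label d = _ := hi 0
    have h1 : T.label (T.next d) = _ := hi 1
    have h4 : T.label ((T.next ^ 4) d) = _ := hi 4
    rw [h0] at hd
    rw [h1, h4]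
    clear h0 h1 h4 hi hc
    revert i s
    decide
  obtain ⟨d, hd⟩ : ∃ d, T.label d = .β := by
    obtain ⟨⟨d⟩, -⟩ := h.connected
    obtain ⟨i, s, hi⟩ := hc d
    have : ∃ j, adjacentWord (turn s i j) = .β := by
      clear hi hc
      revert i s
      decide
    obtain ⟨j, hj⟩ := this
    exact ⟨_, (hi j).trans hj⟩
  have hd1 := (h.label_rot d).trans hd
  have hd2 := (h.label_rot _).trans hd1
  have k0 := key d hd
  have k1 := key _ hd1
  have k2 := key _ hd2
  rw [h.rot_rot_rot d (by rw [hd]; rfl)] at k2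
  rcases k0 with ⟨a, b⟩ | ⟨a, b⟩ <;> simp [a, b] at k1 k2 <;> simp [k1] at k2

theorem exists_isAt (h : T.IsReduced n k) (d : D) : ∃ i s, T.IsAt d i s := by
  obtain ⟨w, hw, hc⟩ := h.congruent
  obtain ⟨c, s, hw | hw⟩ := word_classification hw
  · exact (T.cornerCongruent_iff _).1 (hc.congr_turn hw) d
  · exact (h.not_adjacent (hc.congr_turn hw)).elim

theorem isAt_next (h : T.IsReduced n k) {d : D} {i : Fin 5} {s : Bool} (hi : T.IsAt d i s) :
    T.IsAt (T.next d) (turn s i 1) s := by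
  intro j
  have h1 : (T.next ^ (j : ℕ)) (T.next d) = (T.next ^ ((j + 1 : Fin 5) : ℕ)) d := by
    rw [← Equiv.Perm.mul_apply, ← pow_succ]
    fin_cases j
    iterate 4 rfl
    exact h.next_pow d
  rw [h1, hi]
  congr 1
  clear hi h1
  revert s i j
  decide

theorem isAt_rot (h : T.IsReduced n k) {d : D} {i : Fin 5} {s : Bool} (hi : T.IsAt d i s)
    (hα : reducedWord i = .α) :
    ∃ i', T.IsAt (T.rot d) i' s ∧ (s = true → i' = ![0, 4, 2, 1, 3] i) := by
  obtain ⟨i', s', hi'⟩ := h.exists_isAt (T.rot d)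
  obtain ⟨i'', s'', hi''⟩ := h.exists_isAt (T.rot (T.rot d))
  have hzero : ∀ {d i s}, T.IsAt d i s → T.label d = reducedWord i := by
    intro d i s hd
    have : T.label d = _ := hd 0
    rw [this]
    simp [turn]
  have hd : T.label d = .α := (hzero hi).trans hα
  have hd1 := (h.label_rot d).trans hd
  have hd2 := (h.label_rot _).trans hd1
  have h0 : T.label (T.next d) = _ := hi 1
  have h1 : T.label (T.next (T.rot d)) = _ := hi' 1
  have h2 : T.label (T.next (T.rot (T.rot d))) = _ := hi'' 1
  have h3 := h.label_next_rot (T.rot (T.rot d))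
  rw [h.rot_rot_rot d (by rw [hd]; rfl)] at h3
  obtain ⟨rfl, hs⟩ := reducedWord_vertex s s' s'' i hα i' ((hzero hi').symm.trans hd1)
    (h1.symm.trans ((h.label_next_rot d).trans (hi 4))) i'' ((hzero hi'').symm.trans hd2)
    (h2.symm.trans ((h.label_next_rot _).trans (hi' 4)))
    (h0.symm.trans (h3.trans (hi'' 4)))
  exact ⟨i', hi', hs⟩

theorem isAt_opp_of_next (h : T.IsReduced n k) {d : D} {i : Fin 5} {s : Bool} (hi : T.IsAt d i s)
    (hα : reducedWord (turn s i 1) = .α) :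
    ∃ i', T.IsAt (T.opp d) i' s ∧ (s = true → i' = oppIndex i) := by
  obtain ⟨i', hi', hs⟩ := h.isAt_rot (h.isAt_next hi) hα
  rw [← T.opp_eq_rot_next] at hi'
  refine ⟨i', hi', fun ht => ?_⟩
  rw [hs ht]
  subst ht
  clear hs hi' hi
  revert i
  decide

/-- Since `β` and `γ` are not adjacent, one end of every edge is an `α` vertex, where the
orientations of the tiles agree. Thus the orientation passes across every edge. -/
theorem isAt_opp (h : T.IsReduced n k) {d : D} {i : Fin 5} {s : Bool} (hi : T.IsAt d i s) :
    ∃ i', T.IsAt (T.opp d) i' s ∧ (s = true → i' = oppIndex i) := by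
  by_cases hα : reducedWord (turn s i 1) = .α
  · exact h.isAt_opp_of_next hi hα
  have hα' : reducedWord i = .α := by
    clear hi
    revert s i
    decide
  obtain ⟨i', s', hi'⟩ := h.exists_isAt (T.opp d)
  have h1 : T.label (T.next (T.opp d)) = reducedWord i := by
    rw [← h.label_opp, T.opp_opp]
    have : T.label d = _ := hi 0
    rw [this]
    simp [turn]
  have h2 : T.label (T.next (T.opp d)) = reducedWord (turn s' i' 1) := hi' 1
  -- The edge is traversed backwards, so that it ends in `α`; uniqueness of position and direction
  -- carries the result back to `d`, and `oppIndex` is an involution.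
  obtain ⟨j, hj, hs⟩ := h.isAt_opp_of_next hi' (h2.symm.trans (h1.trans hα'))
  rw [T.opp_opp] at hj
  obtain ⟨rfl, rfl⟩ := hi.unique hj
  refine ⟨i', hi', fun ht => ?_⟩
  rw [hs ht]
  clear * -
  revert i'
  decide

theorem exists_orientation [Finite D] (h : T.IsReduced n k) :
    ∃ s, ∀ d, ∃ i, T.IsAt d i s := by
  obtain ⟨⟨d₀⟩, hP⟩ := T.connected_iff.1 h.connected
  obtain ⟨i, s, hi⟩ := h.exists_isAt d₀
  refine ⟨s, fun d => hP (fun d => ∃ i, T.IsAt d i s) ?_ ?_ d₀ d ⟨i, hi⟩⟩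
  · rintro d ⟨i, hi⟩
    exact ⟨_, h.isAt_next hi⟩
  · rintro d ⟨i, hi⟩
    obtain ⟨i', hi', -⟩ := h.isAt_opp hi
    exact ⟨i', hi'⟩

end IsReduced

theorem IsAt.mirror {T : LabeledMap D Angle} (h5 : ∀ d, (T.next ^ 5) d = d) {d : D} {i : Fin 5}
    (hi : T.IsAt d i false) : T.mirror.IsAt d i true := by
  intro j
  rw [T.mirror_next_pow h5]
  exact (hi _).trans (by simp [turn])

/-- The darts of every tile are numbered counterclockwise, compatibly with the labels, as in a
pentagonal subdivision. -/
structure IsIndexedBy (T : LabeledMap D Angle) (idx : D → Fin 5) : Prop where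
  next : ∀ d, idx (T.next d) = idx d + 1
  opp : ∀ d, idx (T.opp d) = oppIndex (idx d)
  label : ∀ d, T.label d = reducedWord (idx d)

theorem IsReduced.exists_isIndexedBy {T : LabeledMap D Angle} {n k : ℕ} (h : T.IsReduced n k)
    (hs : ∀ d, ∃ i, T.IsAt d i true) : ∃ idx, T.IsIndexedBy idx := by
  choose idx hidx using hs
  refine ⟨idx, fun d => ?_, fun d => ?_, fun d => ?_⟩
  · exact ((hidx _).unique (h.isAt_next (hidx d))).1
  · obtain ⟨i', hi', hs⟩ := h.isAt_opp (hidx d)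
    rw [((hidx _).unique hi').1, hs rfl]
  · have : T.label d = _ := hidx d 0
    rw [this]
    simp [turn]

theorem IsReduced.exists_isIndexedBy_or_mirror [Finite D] {T : LabeledMap D Angle} {n k : ℕ}
    (h : T.IsReduced n k) :
    (∃ idx, T.IsIndexedBy idx) ∨ ∃ idx, T.mirror.IsIndexedBy idx := by
  obtain ⟨s, hs⟩ := h.exists_orientation
  cases s with
  | true => exact Or.inl (h.exists_isIndexedBy hs)
  | false =>
    refine Or.inr (h.mirror.exists_isIndexedBy fun d => ?_)
    obtain ⟨i, hi⟩ := hs d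
    exact ⟨i, hi.mirror h.next_pow⟩

end LabeledMap

end SphereTiling

/-! ### Pentagonal subdivision and its inverse, the contraction. -/

namespace SphereTiling

open Function
open scoped Fin.CommRing

theorem LabeledMap.isomorphic_of_bijective {D D' L : Type*} {T : LabeledMap D L}
    {T' : LabeledMap D' L} (f : D' → D) (hf : Bijective f)
    (hn : ∀ x, f (T'.next x) = T.next (f x)) (ho : ∀ x, f (T'.opp x) = T.opp (f x))
    (hl : ∀ x, T'.label x = T.label (f x)) : T.Isomorphic T' := by
  have hs : ∀ d, f ((Equiv.ofBijective f hf).symm d) = d := (Equiv.ofBijective f hf).apply_symm_apply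
  refine ⟨(Equiv.ofBijective f hf).symm, fun d => ⟨?_, ?_, ?_⟩⟩
  · rw [Equiv.symm_apply_eq, Equiv.ofBijective_apply, hn, hs]
  · rw [Equiv.symm_apply_eq, Equiv.ofBijective_apply, ho, hs]
  · rw [hl, hs]

theorem LabeledMap.Isomorphic.symm {D D' L : Type*} {T : LabeledMap D L} {T' : LabeledMap D' L}
    (h : T.Isomorphic T') : T'.Isomorphic T := by
  obtain ⟨e, he⟩ := h
  exact isomorphic_of_bijective e e.bijective (fun x => (he x).1) (fun x => (he x).2.1)
    fun x => (he x).2.2.symm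

theorem LabeledMap.Isomorphic.trans {D D' D'' L : Type*} {T : LabeledMap D L}
    {T' : LabeledMap D' L} {T'' : LabeledMap D'' L} (h : T.Isomorphic T')
    (h' : T'.Isomorphic T'') : T.Isomorphic T'' := by
  obtain ⟨e, he⟩ := h
  obtain ⟨e', he'⟩ := h'
  refine ⟨e.trans e', fun d => ⟨?_, ?_, ?_⟩⟩
  · simp only [Equiv.trans_apply, (he _).1, (he' _).1]
  · simp only [Equiv.trans_apply, (he _).2.1, (he' _).2.1]
  · simp only [Equiv.trans_apply, (he' _).2.2, (he _).2.2]

/-- The 3A reduction of the pentagonal subdivision of a cell decomposition. -/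
def reducedSubdivision {D : Type*} (M : OrientedMap D) : LabeledMap (D × Fin 5) Angle :=
  (pentagonalSubdivision M).relabel reduction3A

section Subdivision

variable {D : Type*} (M : OrientedMap D)

theorem reducedSubdivision_label (d : D) (i : Fin 5) :
    (reducedSubdivision M).label (d, i) = reducedWord i := by
  fin_cases i <;> rfl

theorem reducedSubdivision_next (d : D) (i : Fin 5) :
    (reducedSubdivision M).next (d, i) = (d, i + 1) := rfl

theorem reducedSubdivision_next_pow (d : D) (i : Fin 5) (j : ℕ) :
    ((reducedSubdivision M).next ^ j) (d, i) = (d, i + (j : Fin 5)) := by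
  induction j with
  | zero => simp
  | succ j ih =>
    rw [pow_succ', Equiv.Perm.mul_apply, ih, reducedSubdivision_next, add_assoc]
    simp

theorem reducedSubdivision_opp (x : D × Fin 5) :
    (reducedSubdivision M).opp x = subdivisionOpp M x := rfl

theorem reducedSubdivision_rot_zero (d : D) :
    (reducedSubdivision M).rot (d, 0) = (M.next d, 0) := rfl

theorem reducedSubdivision_rot_two (d : D) :
    (reducedSubdivision M).rot (d, 2) = (M.rot d, 2) := rfl

/-- The tiles are the darts of `M`. Crossing sides 4 and 3 of the tile `d` leads to the tiles `next
d` and `opp d`, and the other crossings are composites of these moves and their inverses. -/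
theorem reducedSubdivision_connected_iff [Finite D] :
    (reducedSubdivision M).Connected ↔ M.Connected := by
  rw [OrientedMap.connected_iff, OrientedMap.connected_iff]
  refine and_congr ⟨fun ⟨x⟩ => ⟨x.1⟩, fun ⟨x⟩ => ⟨(x, 0)⟩⟩ ⟨fun h P hn ho d e hd => ?_,
    fun h P hn ho => ?_⟩
  · refine h (fun x => P x.1) (fun x hx => hx) ?_ (d, 0) (e, 0) hd
    have hni := finite_perm_inv_closed _ hn
    rintro ⟨x, i⟩ hx
    rw [reducedSubdivision_opp]
    fin_cases i
    · exact hni _ hx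
    · exact ho _ (hni _ hx)
    · exact hn _ (ho _ hx)
    · exact ho _ hx
    · exact hn _ hx
  · have hrow : ∀ d i j, P (d, i) → P (d, j) := by
      intro d i j hd
      have hj : ∀ m : ℕ, P (((reducedSubdivision M).next ^ m) (d, i)) := by
        intro m
        induction m with
        | zero => exact hd
        | succ m ih => rw [pow_succ']; exact hn _ ih
      have := hj ((j - i : Fin 5) : ℕ)
      rw [reducedSubdivision_next_pow] at this
      simpa using this
    rintro ⟨d, i⟩ ⟨e, j⟩ hd
    refine hrow e 0 j (h (fun d => P (d, 0)) (fun d hd => ?_) (fun d hd => ?_) d e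
      (hrow d i 0 hd))
    · exact ho _ (hrow d 0 4 hd)
    · exact hrow _ 3 0 (ho _ (hrow d 0 3 hd))

theorem reducedSubdivision_rot_rot_rot (d : D) {i : Fin 5} (hi : reducedWord i = .α) :
    (reducedSubdivision M).rot ((reducedSubdivision M).rot ((reducedSubdivision M).rot (d, i))) =
      (d, i) := by
  fin_cases i
  · exact absurd hi (by decide)
  · change (M.next (M.opp (M.opp (M.next⁻¹ d))), (1 : Fin 5)) = (d, 1)
    simp [M.opp_opp]
  · exact absurd hi (by decide)
  · change (M.opp (M.next⁻¹ (M.next (M.opp d))), (3 : Fin 5)) = (d, 3)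
    simp [M.opp_opp]
  · change (M.next⁻¹ (M.next (M.opp (M.opp d))), (4 : Fin 5)) = (d, 4)
    simp [M.opp_opp]

theorem reducedSubdivision_label_rot (x : D × Fin 5) :
    (reducedSubdivision M).label ((reducedSubdivision M).rot x) =
      (reducedSubdivision M).label x := by
  obtain ⟨d, i⟩ := x
  fin_cases i <;> rfl

variable {M}

/-- For simplicity of the tiles, two corners of one tile at the same vertex have the same label, so
only `α` matters. The three corners at an `α` vertex are known explicitly, and two of them in one
tile would give a fixed point of `next`, `opp` or `rot`; these are excluded by the periods `k ≠ 1`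
and 3. -/
theorem reducedSubdivision_isReduced [Finite D] {n k : ℕ} (hconn : M.Connected)
    (hcard : Nat.card D = n) (hk : k ≠ 1) (hnext : ∀ d, minimalPeriod M.next d = k)
    (hrot : ∀ d, minimalPeriod M.rot d = 3) : (reducedSubdivision M).IsReduced n k := by
  have hnf : ∀ d, M.next d ≠ d := by
    intro d hd
    rw [← hnext d, Ne, minimalPeriod_eq_one_iff_isFixedPt] at hk
    exact hk hd
  have hrf : ∀ d, M.rot d ≠ d := by
    intro d hd
    have := minimalPeriod_eq_one_iff_isFixedPt.2 hd
    rw [hrot] at this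
    contradiction
  have hnif : ∀ d, M.next⁻¹ d ≠ d := by
    intro d hd
    rw [Equiv.Perm.inv_eq_iff_eq] at hd
    exact hnf d hd.symm
  have hrif : ∀ d, M.next (M.opp d) ≠ d := by
    intro d hd
    apply hrf d
    rw [M.rot_apply]
    nth_rw 1 [← hd]
    simp [M.opp_opp]
  refine ⟨(reducedSubdivision_connected_iff M).2 hconn, ?_, ?_, ?_, ⟨reducedWord, by decide, ?_⟩,
    reducedSubdivision_label_rot M, ?_⟩
  · rw [Nat.card_prod, hcard, mul_comm]
    simp
  · rintro ⟨d, i⟩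
    rw [reducedSubdivision_next_pow]
    simp
  · have key : ∀ d i j, (reducedSubdivision M).source (d, i) = (reducedSubdivision M).source (d, j) →
        i = j := by
      intro d i j hij
      have hl := (reducedSubdivision M).label_eq_of_source_eq (reducedSubdivision_label_rot M) hij
      rw [reducedSubdivision_label, reducedSubdivision_label] at hl
      by_cases hi : reducedWord i = .α
      · rw [OrientedMap.source_eq_source] at hij
        rcases sameCycle_eq_of_apply_three hij (reducedSubdivision_rot_rot_rot M d hi) with h | h | h
        · exact (congrArg Prod.snd h).symm
        all_goals
          exfalso
          have h' := congrArg Prod.fst h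
          fin_cases i
        · exact absurd hi (by decide)
        · exact hnif d h'.symm
        · exact absurd hi (by decide)
        · exact hrif d h'.symm
        · exact M.opp_ne d h'.symm
        · exact absurd hi (by decide)
        · exact hrf d h'.symm
        · exact absurd hi (by decide)
        · have h'' : d = M.next⁻¹ (M.next (M.opp d)) := h'
          rw [M.next_inv_next] at h''
          exact M.opp_ne d h''.symm
        · have h'' : d = M.next (M.opp (M.opp d)) := h'
          rw [M.opp_opp] at h''
          exact hnf d h''.symm
      · clear hij
        revert i j
        decide
    rintro ⟨d, l⟩ i j hij
    simp only [reducedSubdivision_next_pow] at hij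
    simpa using key _ _ _ hij
  · rintro ⟨d, i⟩
    refine ⟨i, Or.inl fun j => ?_⟩
    rw [reducedSubdivision_next_pow, reducedSubdivision_label]
    simp
  · rintro ⟨d, i⟩
    rw [reducedSubdivision_label]
    by_cases hi : reducedWord i = .α
    · rw [hi]
      have : Fact (Nat.Prime 3) := ⟨Nat.prime_three⟩
      change _ = 3
      refine minimalPeriod_eq_prime (reducedSubdivision_rot_rot_rot M d hi) fun h => ?_
      have h' := congrArg Prod.snd h
      fin_cases i
      · exact absurd hi (by decide)
      · exact absurd (show (4 : Fin 5) = 1 from h') (by decide)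
      · exact absurd hi (by decide)
      · exact absurd (show (1 : Fin 5) = 3 from h') (by decide)
      · exact absurd (show (3 : Fin 5) = 4 from h') (by decide)
    · have hi' : i = 0 ∨ i = 2 := by
        revert i
        decide
      rcases hi' with rfl | rfl
      · rw [minimalPeriod_conj (e := fun d : D => (d, (0 : Fin 5)))
          (Prod.mk_left_injective _) (fun d => (reducedSubdivision_rot_zero M d).symm), hnext]
        rfl
      · rw [minimalPeriod_conj (e := fun d : D => (d, (2 : Fin 5)))
          (Prod.mk_left_injective _) (fun d => (reducedSubdivision_rot_two M d).symm), hrot]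
        rfl

/-- Isomorphic cell decompositions have isomorphic reduced pentagonal subdivisions. -/
theorem reducedSubdivision_isomorphic {D' : Type*} {M' : OrientedMap D'} (e : D' → D)
    (he : Bijective e) (hn : ∀ x, e (M'.next x) = M.next (e x))
    (ho : ∀ x, e (M'.opp x) = M.opp (e x)) :
    (reducedSubdivision M).Isomorphic (reducedSubdivision M') := by
  have hni : ∀ x, e (M'.next⁻¹ x) = M.next⁻¹ (e x) := by
    intro x
    rw [Equiv.Perm.eq_inv_iff_eq, ← hn, M'.next_next_inv]
  refine LabeledMap.isomorphic_of_bijective (Prod.map e id) (he.prodMap bijective_id)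
    (fun x => rfl) ?_ ?_
  · rintro ⟨x, i⟩
    rw [reducedSubdivision_opp, reducedSubdivision_opp]
    fin_cases i
    · exact Prod.ext (hni _) rfl
    · exact Prod.ext ((ho _).trans (congrArg _ (hni _))) rfl
    · exact Prod.ext ((hn _).trans (congrArg _ (ho _))) rfl
    · exact Prod.ext (ho _) rfl
    · exact Prod.ext (hn _) rfl
  · rintro ⟨x, i⟩
    rw [reducedSubdivision_label, Prod.map_apply, reducedSubdivision_label]
    rfl

end Subdivision

namespace LabeledMap

variable {D : Type*} {T : LabeledMap D Angle} {n k : ℕ} {idx : D → Fin 5}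

theorem IsIndexedBy.next_inv (hI : T.IsIndexedBy idx) (d : D) :
    idx (T.next⁻¹ d) = idx d - 1 := by
  have := hI.next (T.next⁻¹ d)
  rw [T.next_next_inv] at this
  rw [this, add_sub_cancel_right]

theorem IsIndexedBy.rot (hI : T.IsIndexedBy idx) (d : D) :
    idx (T.rot d) = oppIndex (idx d - 1) := by
  rw [T.rot_apply, hI.opp, hI.next_inv]

theorem IsReduced.next_five (h : T.IsReduced n k) (d : D) :
    T.next (T.next (T.next (T.next (T.next d)))) = d := h.next_pow d

theorem IsIndexedBy.contraction_opp (hI : T.IsIndexedBy idx) {d : D} (hd : idx d = 0) :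
    idx (T.next (T.next (T.opp (T.next (T.next (T.next d)))))) = 0 := by
  simp only [hI.next, hI.opp, hd]
  decide

/-- The opposite darts in the contraction of a tiling, see `contraction`. -/
def contractionOpp (hI : T.IsIndexedBy idx) (d : {d // idx d = 0}) : {d // idx d = 0} :=
  ⟨T.next (T.next (T.opp (T.next (T.next (T.next d.1))))), hI.contraction_opp d.2⟩

theorem contractionOpp_involutive (h : T.IsReduced n k) (hI : T.IsIndexedBy idx) :
    Involutive (contractionOpp hI) := fun d => Subtype.ext <| by
  change T.next (T.next (T.opp (T.next (T.next (T.next (T.next (T.next _))))))) = _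
  rw [h.next_five, T.opp_opp, h.next_five]

/-- The cell decomposition with the `γ` corners of `T` as its corners, of which `T` is the
pentagonal subdivision. -/
def contraction (h : T.IsReduced n k) (hI : T.IsIndexedBy idx) :
    OrientedMap {d // idx d = 0} where
  next := T.rot.subtypePerm fun d => by
    rw [hI.rot]
    generalize idx d = i
    revert i
    decide
  opp := (contractionOpp_involutive h hI).toPerm
  opp_opp := contractionOpp_involutive h hI
  opp_ne d hd := by
    have h1 : T.next (T.next (T.next (T.next (T.next (T.opp (T.next (T.next (T.next d.1)))))))) =
      T.next (T.next (T.next d.1)) := congrArg (fun x => T.next (T.next (T.next x.1))) hd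
    rw [h.next_five] at h1
    exact T.opp_ne _ h1

theorem coe_contraction_next (h : T.IsReduced n k) (hI : T.IsIndexedBy idx)
    (d : {d // idx d = 0}) : ((contraction h hI).next d : D) = T.rot d := rfl

theorem coe_contraction_next_inv (h : T.IsReduced n k) (hI : T.IsIndexedBy idx)
    (d : {d // idx d = 0}) : ((contraction h hI).next⁻¹ d : D) = T.next (T.opp d) := by
  have h1 := congrArg Subtype.val ((contraction h hI).next_next_inv d)
  rw [coe_contraction_next, T.rot_apply] at h1
  rw [← h1, T.opp_opp, T.next_next_inv]

theorem coe_contraction_opp (h : T.IsReduced n k) (hI : T.IsIndexedBy idx)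
    (d : {d // idx d = 0}) : ((contraction h hI).opp d : D) =
      T.next (T.next (T.opp (T.next (T.next (T.next d.1))))) := rfl

/-- This is `rot³ = 1` at an `α` corner, rearranged to remove the inverses on the left. -/
theorem next_opp_next_opp (h : T.IsReduced n k) (hI : T.IsIndexedBy idx) {d : D}
    (hd : reducedWord (idx d) = .α) :
    T.next (T.opp (T.next (T.opp d))) = T.opp (T.next⁻¹ d) := by
  have h3 := h.rot_rot_rot d (by rw [hI.label, hd]; rfl)
  simp only [T.rot_apply] at h3
  nth_rw 1 [← h3]
  simp only [T.opp_opp, T.next_next_inv]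

/-- The same relation at the `α` corner `T.next d`, solved for `T.opp (T.next d)`. -/
theorem next_pow_four_opp (h : T.IsReduced n k) (hI : T.IsIndexedBy idx) {d : D}
    (hd : idx d = 0) :
    T.next (T.next (T.next (T.next (T.opp (T.next (T.next (T.next (T.next (T.opp d))))))))) =
      T.opp (T.next d) := by
  have h1 := next_opp_next_opp h hI (d := T.next d) (by rw [hI.next, hd]; rfl)
  rw [T.next_inv_next] at h1
  rw [← h1, h.next_five, T.opp_opp, h.next_five]

theorem contraction_rot_rot_rot (h : T.IsReduced n k) (hI : T.IsIndexedBy idx)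
    (d : {d // idx d = 0}) : (contraction h hI).rot ((contraction h hI).rot
      ((contraction h hI).rot d)) = d := by
  -- Two steps after a `γ` corner comes the `β` corner of the tile. Rotation in the contraction is
  -- rotation about that `β³` vertex, hence of order 3.
  have hrot : ∀ d : {d // idx d = 0}, T.next (T.next ((contraction h hI).rot d : D)) =
      T.rot (T.next (T.next d)) := by
    intro d
    rw [OrientedMap.rot_apply, coe_contraction_opp, coe_contraction_next_inv, T.rot_apply,
      T.next_inv_next, next_pow_four_opp h hI d.2]
  apply Subtype.ext
  apply T.next.injective
  apply T.next.injective
  rw [hrot, hrot, hrot, h.rot_rot_rot]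
  rw [hI.label, hI.next, hI.next, d.2]
  rfl

/-- A tiling whose tiles are numbered compatibly is the reduced pentagonal subdivision of its
contraction. -/
theorem isomorphic_contraction (h : T.IsReduced n k) (hI : T.IsIndexedBy idx) :
    T.Isomorphic (reducedSubdivision (contraction h hI)) := by
  have hpow : ∀ (i : ℕ) d, idx ((T.next ^ i) d) = idx d + (i : Fin 5) := by
    intro i d
    induction i with
    | zero => simp
    | succ i ih => rw [pow_succ', Equiv.Perm.mul_apply, hI.next, ih, Nat.cast_succ, add_assoc]
  have hidx : ∀ x : {d // idx d = 0} × Fin 5, idx ((T.next ^ (x.2 : ℕ)) x.1) = x.2 := by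
    intro x
    rw [hpow, x.1.2]
    simp
  refine isomorphic_of_bijective (fun x => (T.next ^ (x.2 : ℕ)) x.1) ⟨?_, ?_⟩ ?_ ?_ ?_
  · rintro x y hxy
    have h2 : x.2 = y.2 := by rw [← hidx x, ← hidx y]; exact congrArg idx hxy
    refine Prod.ext (Subtype.ext ?_) h2
    simp only [h2] at hxy
    exact (T.next ^ (y.2 : ℕ)).injective hxy
  · intro d
    -- Every dart is reached from the `γ` corner of its tile in `idx d` steps.
    refine ⟨(⟨(T.next ^ ((-idx d : Fin 5) : ℕ)) d, by rw [hpow]; simp⟩, idx d), ?_⟩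
    change (T.next ^ (idx d : ℕ)) ((T.next ^ ((-idx d : Fin 5) : ℕ)) d) = d
    rw [← Equiv.Perm.mul_apply, ← pow_add]
    generalize idx d = i
    fin_cases i
    · rfl
    all_goals exact h.next_pow d
  · rintro ⟨d, i⟩
    change (T.next ^ ((i + 1 : Fin 5) : ℕ)) d.1 = T.next ((T.next ^ (i : ℕ)) d.1)
    fin_cases i
    iterate 4 rfl
    exact (h.next_pow d).symm
  · rintro ⟨d, i⟩
    rw [reducedSubdivision_opp]
    fin_cases i
    · change T.next (T.next (T.next (T.next ((contraction h hI).next⁻¹ d).1))) = T.opp d.1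
      rw [coe_contraction_next_inv, h.next_five]
    · change T.next (T.next ((contraction h hI).opp ((contraction h hI).next⁻¹ d)).1) =
        T.opp (T.next d)
      rw [coe_contraction_opp, coe_contraction_next_inv, next_pow_four_opp h hI d.2]
    · change T.next ((contraction h hI).next ((contraction h hI).opp d)).1 =
        T.opp (T.next (T.next d))
      rw [coe_contraction_next, coe_contraction_opp, T.rot_apply, T.next_inv_next,
        next_opp_next_opp h hI (by rw [hI.next, hI.next, hI.next, d.2]; rfl), T.next_inv_next]
    · change T.next (T.next (T.next ((contraction h hI).opp d).1)) =
        T.opp (T.next (T.next (T.next d)))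
      rw [coe_contraction_opp, h.next_five]
    · change T.rot d = T.opp (T.next (T.next (T.next (T.next d))))
      rw [T.rot_apply, h.next_inv_apply]
      rfl
  · rintro ⟨d, i⟩
    rw [reducedSubdivision_label, hI.label]
    exact (congrArg reducedWord (hidx (d, i))).symm

theorem contraction_next_pow (h : T.IsReduced n k) (hI : T.IsIndexedBy idx)
    (d : {d // idx d = 0}) : ((contraction h hI).next ^ k) d = d := by
  have hp : ∀ j : ℕ, (((contraction h hI).next ^ j) d : D) = (T.rot^[j]) d := by
    intro j
    induction j with
    | zero => rfl
    | succ j ih =>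
      rw [pow_succ', Equiv.Perm.mul_apply, coe_contraction_next, ih, iterate_succ_apply']
  apply Subtype.ext
  rw [hp]
  have := h.period d
  rw [hI.label, d.2] at this
  have h3 := isPeriodicPt_minimalPeriod T.rot d
  rw [this] at h3
  exact h3

theorem contraction_card [Finite D] (h : T.IsReduced n k) (hI : T.IsIndexedBy idx) :
    Nat.card {d // idx d = 0} = n := by
  obtain ⟨e, -⟩ := isomorphic_contraction h hI
  have := Nat.card_congr e
  rw [h.card, Nat.card_prod, Nat.card_fin] at this
  omega

theorem contraction_connected [Finite D] (h : T.IsReduced n k) (hI : T.IsIndexedBy idx) :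
    (contraction h hI).Connected :=
  (reducedSubdivision_connected_iff _).1
    (h.of_isomorphic (isomorphic_contraction h hI).symm).connected

end LabeledMap

end SphereTiling

/-! ### Uniqueness of the cube. -/

namespace SphereTiling

open Function

/-- The image is closed under `next` and `opp`, so it is everything by connectedness; the
cardinalities then give injectivity. -/
theorem OrientedMap.bijective_of_equivariant {D D' : Type*} [Finite D] [Finite D'] [Nonempty D']
    {M : OrientedMap D} {M' : OrientedMap D'} (hM : M.Connected)
    (hcard : Nat.card D' ≤ Nat.card D) (e : D' → D) (hn : ∀ x, e (M'.next x) = M.next (e x))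
    (ho : ∀ x, e (M'.opp x) = M.opp (e x)) : Bijective e := by
  refine Surjective.bijective_of_nat_card_le (fun d => ?_) hcard
  obtain ⟨x⟩ := ‹Nonempty D'›
  refine (M.connected_iff.1 hM).2 (fun y => ∃ a, e a = y) ?_ ?_ (e x) d ⟨x, rfl⟩
  · rintro _ ⟨a, rfl⟩
    exact ⟨_, hn a⟩
  · rintro _ ⟨a, rfl⟩
    exact ⟨_, ho a⟩

section Cube

/-- The image of the dart `(v, i)` of the cube under the map that sends `(0, 0)` to `b`, where `o`
and `r` stand for the opposite dart and for the rotation about the starting point. -/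
def cubeWord {X : Type*} (o r : X → X) (b : X) (x y z : Bool) (i : Fin 3) : X :=
  r^[(if x ^^ y ^^ z then -i else i : Fin 3)] <|
    match x, y, z with
    | false, false, false => b
    | true, false, false => o b
    | false, true, false => r (o (r b))
    | false, false, true => r (r (o (r (r b))))
    | true, true, false => r (r (o (r (r (o b)))))
    | true, false, true => r (o (r (o b)))
    | false, true, true => r (o (r (r (o (r b)))))
    | true, true, true => r (r (o (r (o (r (r (o b)))))))

variable {X : Type*} {o r : X → X}

/-- At odd vertices rotation lowers the direction by one; the exponent `-i` in `cubeWord`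
compensates for this, so in both cases the exponent rises by one modulo 3. -/
theorem cubeWord_rot (hr : ∀ x, r (r (r x)) = x) (b : X) (x y z : Bool) (i : Fin 3) :
    cubeWord o r b x y z (if x ^^ y ^^ z then i - 1 else i + 1) =
      r (cubeWord o r b x y z i) := by
  unfold cubeWord
  generalize (x ^^ y ^^ z) = t
  cases t <;> fin_cases i <;> simp [hr, show (2 : Fin 3) + 1 = 0 from rfl,
    show -(2 : Fin 3) = 1 from rfl, show -(1 : Fin 3) = 2 from rfl,
    show (1 : Fin 3) + 1 = 2 from rfl, show (2 : Fin 3) - 1 = 1 from rfl]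

theorem cubeWord_opp (ho : ∀ x, o (o x) = x) (hr : ∀ x, r (r (r x)) = x)
    (h4 : ∀ x, o (r (o (r (o (r (o (r x))))))) = x) (b : X) (x y z : Bool) :
    cubeWord o r b (!x) y z 0 = o (cubeWord o r b x y z 0) ∧
    cubeWord o r b x (!y) z 1 = o (cubeWord o r b x y z 1) ∧
    cubeWord o r b x y (!z) 2 = o (cubeWord o r b x y z 2) := by
  unfold cubeWord
  cases x <;> cases y <;> cases z <;>
  · simp only [Bool.not_false, Bool.not_true, Bool.xor_false, Bool.xor_true, Bool.false_eq_true,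
      if_true, if_false, show -(2 : Fin 3) = 1 from rfl, show -(1 : Fin 3) = 2 from rfl, neg_zero,
      Fin.val_zero, Fin.val_one, Fin.val_two, iterate_zero, iterate_succ, comp_apply, id]
    refine ⟨?_, ?_, ?_⟩ <;> grind

end Cube

theorem cube_rot (v : Fin 3 → Bool) (i : Fin 3) :
    cube.rot (v, i) = (v, if cubeParity v then i - 1 else i + 1) := by
  revert v i
  simp only [OrientedMap.rot_apply]
  decide

theorem OrientedMap.next_eq_rot_rot_opp {D : Type*} (M : OrientedMap D)
    (hr : ∀ d, M.rot (M.rot (M.rot d)) = d) (d : D) : M.next d = M.rot (M.rot (M.opp d)) := by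
  rw [M.opp_eq_rot_next, hr]

/-- A cell decomposition with 24 corners in which all faces are quadrilaterals and all vertices
have degree 3 is the cube. -/
theorem exists_bijective_cube {D : Type*} [Finite D] {M : OrientedMap D} (hM : M.Connected)
    (hcard : Nat.card D = 24) (h4 : ∀ d, (M.next ^ 4) d = d)
    (hr : ∀ d, M.rot (M.rot (M.rot d)) = d) :
    ∃ e : (Fin 3 → Bool) × Fin 3 → D, Bijective e ∧ (∀ x, e (cube.next x) = M.next (e x)) ∧
      ∀ x, e (cube.opp x) = M.opp (e x) := by
  obtain ⟨⟨b⟩, -⟩ := id hM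
  -- Since `opp ∘ rot` is the inverse of `next`, this is the inverted form of `next⁴ = 1`.
  have h4' : ∀ d, M.opp (M.rot (M.opp (M.rot (M.opp (M.rot (M.opp (M.rot d))))))) = d := by
    have h1 : ∀ d, M.next (M.next (M.next (M.next d))) = d := h4
    simp only [M.next_eq_rot_rot_opp hr] at h1
    have ho := M.opp_opp
    grind
  let e : (Fin 3 → Bool) × Fin 3 → D := fun x =>
    cubeWord M.opp M.rot b (x.1 0) (x.1 1) (x.1 2) x.2
  have hrot : ∀ x, e (cube.rot x) = M.rot (e x) := by
    rintro ⟨v, i⟩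
    rw [cube_rot]
    exact cubeWord_rot hr b (v 0) (v 1) (v 2) i
  have hopp : ∀ x, e (cube.opp x) = M.opp (e x) := by
    rintro ⟨v, i⟩
    have h := cubeWord_opp M.opp_opp hr h4' b (v 0) (v 1) (v 2)
    fin_cases i
    · exact h.1
    · exact h.2.1
    · exact h.2.2
  have hnext : ∀ x, e (cube.next x) = M.next (e x) := by
    intro x
    rw [M.next_eq_rot_rot_opp hr, cube.next_eq_rot_rot_opp, hrot, hrot, hopp]
    intro x
    rw [cube_rot, cube_rot, cube_rot]
    revert x
    decide
  refine ⟨e, OrientedMap.bijective_of_equivariant hM ?_ e hnext hopp, hnext, hopp⟩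
  rw [hcard]
  simp

theorem cube_connected : cube.Connected := by
  rw [OrientedMap.connected_iff]
  refine ⟨inferInstance, fun P hn ho => ?_⟩
  have hrot : ∀ x, P x → P (cube.rot x) := fun x hx => ho _ (finite_perm_inv_closed _ hn x hx)
  have hdir : ∀ v i j, P (v, i) → P (v, j) := by
    intro v i j hi
    have h1 := hrot _ hi
    have h2 := hrot _ h1
    rw [cube_rot] at h1
    rw [cube_rot, cube_rot] at h2
    dsimp only at h1 h2
    revert hi h1 h2
    generalize cubeParity v = t
    cases t <;> fin_cases i <;> fin_cases j <;> intro h0 h1 h2 <;> first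
      | exact h0
      | exact h1
      | exact h2
  have hflip : ∀ v i j k, P (v, j) → P (cubeFlip v i, k) := fun v i j k hv =>
    hdir _ i k (ho _ (hdir v j i hv))
  rintro ⟨v, i⟩ ⟨w, j⟩ hv
  have hstep : ∀ v k x i j, P (v, i) → P (update v k x, j) := by
    intro v k x i j hv
    by_cases hx : x = v k
    · rw [hx, update_eq_self]
      exact hdir _ _ _ hv
    · rw [Bool.eq_not.2 hx]
      exact hflip v k i j hv
  -- One vertex is carried to another by correcting the coordinates one at a time, each along an
  -- edge.
  have h3 : update (update (update v 0 (w 0)) 1 (w 1)) 2 (w 2) = w := by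
    ext k
    fin_cases k <;> simp
  rw [← h3]
  exact hstep _ _ _ 0 _ (hstep _ _ _ 0 _ (hstep _ _ _ i _ hv))

theorem minimalPeriod_cube_next (d) : minimalPeriod cube.next d = 4 := by
  have : Fact (Nat.Prime 2) := ⟨Nat.prime_two⟩
  refine minimalPeriod_eq_prime_pow (p := 2) (k := 1) ?_ ?_
  · change cube.next (cube.next d) ≠ d
    revert d
    decide
  · change cube.next (cube.next (cube.next (cube.next d))) = d
    revert d
    decide

theorem minimalPeriod_cube_rot (d) : minimalPeriod cube.rot d = 3 := by
  have : Fact (Nat.Prime 3) := ⟨Nat.prime_three⟩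
  refine minimalPeriod_eq_prime ?_ ?_
  · change cube.rot (cube.rot (cube.rot d)) = d
    rw [cube_rot, cube_rot, cube_rot]
    revert d
    decide
  · change cube.rot d ≠ d
    rw [cube_rot]
    revert d
    decide

end SphereTiling

/-! ### Uniqueness of the dodecahedron. -/

namespace SphereTiling

open Function

section Dodecahedron

variable {X : Type*} {o n : X → X}

/-- The image of the dart `0` of a face of the dodecahedron under the map that sends the dart `0`
of the face `(false, none)` to `b`, where `n` and `o` stand for the next and the opposite dart. -/
def dodecahedronWord (o n : X → X) (b : X) : Bool × Option (Fin 5) → X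
  | (false, none) => b
  | (false, some k) => o (n^[k] b)
  | (true, some k) => n (n (n (o (n (n (o (n^[(-k : Fin 5)] b)))))))
  | (true, none) => o (n (n (n (o (n (n (o b)))))))

theorem iterate_fin_add_one (h5 : ∀ x, n (n (n (n (n x)))) = x) (k : Fin 5) (x : X) :
    n^[(k + 1 : Fin 5)] x = n (n^[k] x) := by
  fin_cases k
  iterate 4 rfl
  exact (h5 x).symm

theorem dodecahedronWord_opp (ho : ∀ x, o (o x) = x) (h5 : ∀ x, n (n (n (n (n x)))) = x)
    (h : ∀ x, o (n (o x)) = n (n (n (n (o (n (n (n (n x))))))))) (b : X)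
    (x : (Bool × Option (Fin 5)) × Fin 5) :
    n^[(dodecahedronOpp x).2] (dodecahedronWord o n b (dodecahedronOpp x).1) =
      o (n^[x.2] (dodecahedronWord o n b x.1)) := by
  set f : (Bool × Option (Fin 5)) × Fin 5 → X := fun x => n^[x.2] (dodecahedronWord o n b x.1)
    with hf
  change f (dodecahedronOpp x) = o (f x)
  -- Each edge needs checking from one side only: `h0` covers sides 0, `h1` covers sides 1 and 4,
  -- and `h2`, `h3` cover the edges between the two halves.
  have hsymm : ∀ x, f (dodecahedronOpp x) = o (f x) →
      f (dodecahedronOpp (dodecahedronOpp x)) = o (f (dodecahedronOpp x)) := by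
    intro x hx
    rw [hx, ho, show dodecahedronOpp (dodecahedronOpp x) = x from dodecahedron.opp_opp x]
  have hpred : ∀ k : Fin 5, n^[k] b = n (n^[(k - 1 : Fin 5)] b) := by
    intro k
    rw [← iterate_fin_add_one h5, sub_add_cancel]
  -- The path `o n³ o n² o` leads from the base face to the opposite face. Starting one step later
  -- arrives one step earlier, which explains the exponents `-k` on the far half.
  have hcap : ∀ z, n (o (n (n (n (o (n (n (o (n z))))))))) = o (n (n (n (o (n (n (o z))))))) := by
    grind
  have h0 : ∀ s k, f (dodecahedronOpp ((s, none), k)) = o (f ((s, none), k)) := by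
    rintro (_ | _) k
    · rfl
    · change n (n (n (o (n (n (o (n^[(-k : Fin 5)] b))))))) =
        o (n^[k] (o (n (n (n (o (n (n (o b)))))))))
      clear hpred
      fin_cases k <;> simp [show -(1 : Fin 5) = 4 from rfl, show -(2 : Fin 5) = 3 from rfl,
        show -(3 : Fin 5) = 2 from rfl, show -(4 : Fin 5) = 1 from rfl] <;> grind
  have h1 : ∀ s k, f (dodecahedronOpp ((s, some k), 1)) = o (f ((s, some k), 1)) := by
    rintro (_ | _) k
    · change n (n (n (n (o (n^[(k - 1 : Fin 5)] b))))) = o (n (o (n^[k] b)))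
      rw [hpred k, h]
      grind
    · change n (n (n (n (n (n (n (o (n (n (o (n^[(-(k - 1) : Fin 5)] b))))))))))) =
        o (n (n (n (n (o (n (n (o (n^[(-k : Fin 5)] b)))))))))
      rw [neg_sub, ← neg_add_eq_sub, iterate_fin_add_one h5]
      grind
  have h2 : ∀ k, f (dodecahedronOpp ((false, some k), 2)) = o (f ((false, some k), 2)) := by
    intro k
    change n (n (n (n (n (o (n (n (o (n^[(- -k : Fin 5)] b))))))))) = o (n (n (o (n^[k] b))))
    rw [neg_neg, h5]
  have h3 : ∀ k, f (dodecahedronOpp ((false, some k), 3)) = o (f ((false, some k), 3)) := by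
    intro k
    change n (n (n (n (n (n (o (n (n (o (n^[(-(-k - 1) : Fin 5)] b)))))))))) =
      o (n (n (n (o (n^[k] b)))))
    rw [neg_sub, sub_neg_eq_add, add_comm 1 k, iterate_fin_add_one h5, h5]
    grind
  obtain ⟨⟨s, _ | k⟩, i⟩ := x
  · exact h0 s i
  · fin_cases i
    · exact hsymm _ (h0 s k)
    · exact h1 s k
    · cases s
      · exact h2 k
      · have := hsymm _ (h2 (-k))
        simpa [dodecahedronOpp] using this
    · cases s
      · exact h3 k
      · have := hsymm _ (h3 (-k - 1))
        simpa [dodecahedronOpp] using this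
    · have := hsymm _ (h1 s (k + 1))
      simpa [dodecahedronOpp] using this

end Dodecahedron

/-- A cell decomposition with 60 corners in which all faces are pentagons and all vertices have
degree 3 is the dodecahedron. -/
theorem exists_bijective_dodecahedron {D : Type*} [Finite D] {M : OrientedMap D}
    (hM : M.Connected) (hcard : Nat.card D = 60) (h5 : ∀ d, (M.next ^ 5) d = d)
    (hr : ∀ d, M.rot (M.rot (M.rot d)) = d) :
    ∃ e : (Bool × Option (Fin 5)) × Fin 5 → D, Bijective e ∧
      (∀ x, e (dodecahedron.next x) = M.next (e x)) ∧
      ∀ x, e (dodecahedron.opp x) = M.opp (e x) := by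
  obtain ⟨⟨b⟩, -⟩ := id hM
  have h5' : ∀ d, M.next (M.next (M.next (M.next (M.next d)))) = d := h5
  have hni : ∀ d, M.next⁻¹ d = M.next (M.next (M.next (M.next d))) := by
    intro d
    rw [Equiv.Perm.inv_eq_iff_eq, h5']
  -- With `next⁴` for the inverse of `next`, this is `rot³ = 1` in the form `o n o = n⁻¹ o n⁻¹`.
  have h : ∀ d, M.opp (M.next (M.opp d)) = M.next (M.next (M.next (M.next
      (M.opp (M.next (M.next (M.next (M.next d)))))))) := by
    intro d
    have h3 := hr d
    simp only [M.rot_apply, hni] at h3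
    have ho := M.opp_opp
    grind
  let e : (Bool × Option (Fin 5)) × Fin 5 → D := fun x =>
    M.next^[x.2] (dodecahedronWord M.opp M.next b x.1)
  have hnext : ∀ x, e (dodecahedron.next x) = M.next (e x) := by
    rintro ⟨F, i⟩
    exact iterate_fin_add_one h5' i _
  have hopp : ∀ x, e (dodecahedron.opp x) = M.opp (e x) :=
    dodecahedronWord_opp M.opp_opp h5' h b
  refine ⟨e, OrientedMap.bijective_of_equivariant hM ?_ e hnext hopp, hnext, hopp⟩
  rw [hcard]
  simp

theorem dodecahedron_connected : dodecahedron.Connected := by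
  rw [OrientedMap.connected_iff]
  refine ⟨inferInstance, fun P hn ho => ?_⟩
  have hface : ∀ F i j, P (F, i) → P (F, j) := by
    intro F i j hi
    have hj : ∀ m : ℕ, ∃ l, l = (⟨(i + m) % 5, Nat.mod_lt _ (by norm_num)⟩ : Fin 5) ∧ P (F, l) := by
      intro m
      induction m with
      | zero => exact ⟨i, by ext; simp [Nat.mod_eq_of_lt i.2], hi⟩
      | succ m ih =>
        obtain ⟨l, rfl, hl⟩ := ih
        refine ⟨_, ?_, hn _ hl⟩
        ext
        simp [Fin.val_add, add_assoc]
    -- These many steps lead from side `i` to side `j` modulo 5; the subtraction is exact because `i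
    -- < 5`.
    obtain ⟨l, rfl, hl⟩ := hj (5 - i + j)
    convert hl using 2
    ext
    have := i.2
    have := j.2
    simp only
    omega
  have hout : ∀ s k, P ((s, none), 0) → P ((s, some k), 0) := fun s k h =>
    ho _ (hface _ 0 k h)
  have hin : ∀ s k, P ((s, some k), 0) → P ((s, none), 0) := fun s k h =>
    hface _ k 0 (ho _ h)
  have hcross : ∀ s, P ((s, none), 0) → P ((!s, none), 0) := fun s h =>
    hin _ (-0) (hface _ 2 0 (ho _ (hface _ 0 2 (hout s 0 h))))
  have hcap : ∀ F i, P (F, i) → P ((F.1, none), 0) := by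
    rintro ⟨s, _ | k⟩ i h
    · exact hface _ _ _ h
    · exact hin s k (hface _ _ _ h)
  rintro ⟨F, i⟩ ⟨⟨s, G⟩, j⟩ h
  have h1 := hcap F i h
  have h2 : P ((s, none), 0) := by
    by_cases hs : s = F.1
    · rw [hs]
      exact h1
    · rw [Bool.eq_not.2 hs]
      exact hcross _ h1
  cases G with
  | none => exact hface _ _ _ h2
  | some k => exact hface _ _ _ (hout s k h2)

theorem minimalPeriod_dodecahedron_next (d) : minimalPeriod dodecahedron.next d = 5 := by
  have : Fact (Nat.Prime 5) := ⟨Nat.prime_five⟩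
  refine minimalPeriod_eq_prime ?_ ?_
  · change dodecahedron.next (dodecahedron.next (dodecahedron.next (dodecahedron.next
      (dodecahedron.next d)))) = d
    revert d
    decide
  · change dodecahedron.next d ≠ d
    revert d
    decide

theorem minimalPeriod_dodecahedron_rot (d) : minimalPeriod dodecahedron.rot d = 3 := by
  have : Fact (Nat.Prime 3) := ⟨Nat.prime_three⟩
  refine minimalPeriod_eq_prime ?_ ?_
  · change dodecahedron.rot (dodecahedron.rot (dodecahedron.rot d)) = d
    revert d
    simp only [OrientedMap.rot_apply]
    decide
  · change dodecahedron.rot d ≠ d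
    revert d
    simp only [OrientedMap.rot_apply]
    decide

/-! ### From uniqueness of the base polyhedron to uniqueness of the tiling. -/

namespace LabeledMap

variable {D : Type*} {T : LabeledMap D Angle}

theorem mirror_mirror {L : Type*} (T : LabeledMap D L) : T.mirror.mirror = T := by
  cases T
  simp [mirror, OrientedMap.mirror, mul_assoc]

theorem Equivalent.isReduced {D' : Type*} [Finite D] {T' : LabeledMap D' Angle}
    {n k : ℕ} (h : T.Equivalent T') (h' : T'.IsReduced n k) : T.IsReduced n k :=
  h.elim (fun hi => h'.of_isomorphic hi) fun hi =>
    T.mirror_mirror ▸ (h'.of_isomorphic hi).mirror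

/-- `hM'` is the uniqueness of the base polyhedron. It is needed only on sets of darts of the
tiling, because the contraction lives on the set of `γ` corners. -/
theorem IsReduced.equivalent [Finite D] {D' : Type*} {M' : OrientedMap D'} {n k : ℕ}
    (hM' : ∀ {E : Set D} {M : OrientedMap E}, M.Connected → Nat.card E = n →
      (∀ d, (M.next ^ k) d = d) → (∀ d, M.rot (M.rot (M.rot d)) = d) →
      ∃ e : D' → E, Bijective e ∧ (∀ x, e (M'.next x) = M.next (e x)) ∧
        ∀ x, e (M'.opp x) = M.opp (e x))
    (h : T.IsReduced n k) : T.Equivalent (reducedSubdivision M') := by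
  have key : ∀ {T : LabeledMap D Angle} {idx : D → Fin 5}, T.IsReduced n k → T.IsIndexedBy idx →
      T.Isomorphic (reducedSubdivision M') := by
    intro T idx h hI
    obtain ⟨e, he, hn, ho⟩ := hM' (E := {d | idx d = 0}) (contraction_connected h hI)
      (contraction_card h hI) (contraction_next_pow h hI) (contraction_rot_rot_rot h hI)
    exact (isomorphic_contraction h hI).trans (reducedSubdivision_isomorphic e he hn ho)
  obtain ⟨idx, hI⟩ | ⟨idx, hI⟩ := h.exists_isIndexedBy_or_mirror
  · exact Or.inl (key h hI)
  · exact Or.inr (key h.mirror hI)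

end LabeledMap

end SphereTiling

theorem theorem4 {D : Type*} [Fintype D] (T : SphereTiling.LabeledMap D SphereTiling.Angle) :
    (T.IsTilingFor SphereTiling.AVC3A24 ↔ T.Equivalent SphereTiling.PP6_3A) ∧
    (T.IsTilingFor SphereTiling.AVC3A60 ↔ T.Equivalent SphereTiling.PP12_3A) := by
  open SphereTiling in
  refine ⟨⟨fun h => ?_, fun h => ?_⟩, ⟨fun h => ?_, fun h => ?_⟩⟩
  · have hr := LabeledMap.IsTilingFor.isReduced (a := 24) (b := 8) (c := 6) (k := 4) h
    exact hr.equivalent exists_bijective_cube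
  · have hr := LabeledMap.Equivalent.isReduced h
      (reducedSubdivision_isReduced cube_connected (by simp) (by decide) minimalPeriod_cube_next
        minimalPeriod_cube_rot : PP6_3A.IsReduced 24 4)
    exact hr.isTilingFor (b := 8) (c := 6) (by decide) (by decide) (by decide) (by decide)
  · have hr := LabeledMap.IsTilingFor.isReduced (a := 60) (b := 20) (c := 12) (k := 5) h
    exact hr.equivalent exists_bijective_dodecahedron
  · have hr := LabeledMap.Equivalent.isReduced h
      (reducedSubdivision_isReduced dodecahedron_connected (by simp) (by decide)
        minimalPeriod_dodecahedron_next minimalPeriod_dodecahedron_rot : PP12_3A.IsReduced 60 5)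
    exact hr.isTilingFor (b := 20) (c := 12) (by decide) (by decide) (by decide) (by decide)
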